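/- Let $\Gamma\subset\mathbb{R}^d$, $d\ge 2$, be a rectifiable simple closed curve of length $|\Gamma|$. The geodesic distance $d(x,y)$ of $x,y\in\Gamma$ is the length of the shorter of the two arcs of $\Gamma$ joining $x$ and $y$. For $f:[0,|\Gamma|/2]\to\mathbb{C}\cup\{+\infty\}$ and $N\ge 2$ points $z_{1,N},\dots,z_{N,N}$ that are equally spaced on $\Gamma$ (with respect to arclength) put $$\mathcal{M}(\Gamma,f;N)=\sum_{j\ne k} f\bigl(d(z_{j,N},z_{k,N})\bigr).$$ Let $p\ge 1$ and $q\ge 0$ be integers and suppose that $f$ is admissible, which means: (i) $f$ has a continuous derivative of order $2p+1$ on $(0,|\Gamma|/2]$ (so $f$ is complex-valued there; derivatives at $|\Gamma|/2$ are one-sided); (ii) there are complex numbers $a_0,\dots,a_q$ and $s_0,\dots,s_q$ with $\operatorname{Re}s_0>\operatorname{Re}s_1>\dots>\operatorname{Re}s_q$ and with $\operatorname{Re}s_q+2p>0$ or $s_q=-2p$, and a real $\delta>0$ with $1-\operatorname{Re}s_q+\delta>0$, such that for $S_q(x)=\sum_{n=0}^q a_n x^{-s_n}$ (principal values of the powers),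 as $x\to0^+$, $$\int_0^x (f-S_q)(y)\,dy=\mathcal{O}\bigl(x^{1+\delta-\operatorname{Re}s_q}\bigr),\qquad (f-S_q)^{(\nu)}(x)=\mathcal{O}\bigl(x^{\delta-\operatorname{Re}s_q-\nu}\bigr)\quad(\nu=0,1,\dots,2p+1).$$ Suppose moreover that none of $s_0,\dots,s_q$ equals $1$. Then $f-S_q$ is integrable on $(0,|\Gamma|/2)$ and, for every $N=2M+\kappa\ge 2$ with $\kappa\in\{0,1\}$, $$\mathcal{M}(\Gamma,f;N)=V_f(\Gamma)\,N^2+\sum_{n=0}^q a_n\frac{2\zeta(s_n)}{|\Gamma|^{s_n}}N^{1+s_n}+\mathcal{B}_p(\Gamma,f;N)+\mathfrak{R}_p(\Gamma,f;N),$$ where $\zeta$ is the Riemann zeta function, $$V_f(\Gamma)=\frac{2}{|\Gamma|}\sum_{n=0}^q a_n\frac{(|\Gamma|/2)^{1-s_n}}{1-s_n}+\frac{2}{|\Gamma|}\int_0^{|\Gamma|/2}(f-S_q)(x)\,dx,$$ $$\mathcal{B}_p(\Gamma,f;N)=\frac{2}{|\Gamma|}N^2\sum_{n=1}^p\frac{B_{2n}(\kappa/2)}{(2n)!}\left(\frac{|\Gamma|}{N}\right)^{2n}f^{(2n-1)}(|\Gamma|/2)$$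 with the Bernoulli polynomials $B_m(x)$ given by $\frac{z}{e^z-1}e^{xz}=\sum_{m\ge0}\frac{B_m(x)}{m!}z^m$, and where the remainder $\mathfrak{R}_p(\Gamma,f;N)$, which does not depend on the choice of the equally spaced points, satisfies, as $N\to\infty$, $$\mathfrak{R}_p(\Gamma,f;N)=\mathcal{O}(N^{1-2p})+\mathcal{O}(N^{1-\delta+\operatorname{Re}s_q})\quad\text{if }2p\ne\delta-\operatorname{Re}s_q,$$ $$\mathfrak{R}_p(\Gamma,f;N)=\mathcal{O}(N^{1-2p}\log N)\quad\text{if }2p=\delta-\operatorname{Re}s_q.$$ -/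

import Mathlib

open Set Filter Topology MeasureTheory Asymptotics

noncomputable section

/-- A parametrized rectifiable simple closed curve in Euclidean space `ℝ^d`; only the values of
`toFun` on `[0, 1]` matter. -/
structure RectifiableSimpleClosedCurve (d : ℕ) where
  toFun : ℝ → EuclideanSpace ℝ (Fin d)
  continuousOn : ContinuousOn toFun (Icc 0 1)
  closed : toFun 0 = toFun 1
  simple : InjOn toFun (Ico 0 1)
  rectifiable : eVariationOn toFun (Icc 0 1) ≠ ⊤

namespace RectifiableSimpleClosedCurve

variable {d : ℕ} (Γ : RectifiableSimpleClosedCurve d)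

/-- The set of points of the curve. -/
def carrier : Set (EuclideanSpace ℝ (Fin d)) :=
  Γ.toFun '' Icc 0 1

/-- The length of the piece of the curve with parameters between `t` and `u` (for `t ≤ u`): the
supremum of the lengths of the inscribed polygons. -/
def pieceLength (t u : ℝ) : ℝ :=
  (eVariationOn Γ.toFun (Icc t u)).toReal

/-- The length `|Γ|`. -/
def length : ℝ :=
  Γ.pieceLength 0 1

/-- For a point `x` of the curve, its unique parameter in `[0, 1)`. -/
def param (x : EuclideanSpace ℝ (Fin d)) : ℝ :=
  Function.invFunOn Γ.toFun (Ico 0 1) x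

/-- `ℓ(x, y)`: the length of the arc of `Γ` that leads from `x` to `y` in the direction of the
parametrization. If `y` has the smaller parameter, the arc passes through the point
`Γ 0 = Γ 1`. -/
def arcLength (x y : EuclideanSpace ℝ (Fin d)) : ℝ :=
  if Γ.param x ≤ Γ.param y then Γ.pieceLength (Γ.param x) (Γ.param y)
  else Γ.pieceLength (Γ.param x) 1 + Γ.pieceLength 0 (Γ.param y)

/-- The geodesic distance: the length of the shorter of the two arcs between `x` and `y`. -/
def geodesicDist (x y : EuclideanSpace ℝ (Fin d)) : ℝ :=
  min (Γ.arcLength x y) (Γ.arcLength y x)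

/-- `z 0, …, z (N - 1)` are `N` points that are equally spaced on `Γ` with respect to arclength,
listed in the direction of the parametrization: the arc from each point to the next one has length
`|Γ| / N`. (The arc from the last point to the first one then has this length too, if `2 ≤ N`.) -/
def IsEquallySpaced {N : ℕ} (z : Fin N → EuclideanSpace ℝ (Fin d)) : Prop :=
  (∀ j, z j ∈ Γ.carrier) ∧
    ∀ j k : Fin N, (j : ℕ) + 1 = k → Γ.arcLength (z j) (z k) = Γ.length / N

/-- The discrete geodesic `f`-energy `∑_{j ≠ k} f (d (z j, z k))`, computed in `ℂ ∪ {+∞}`. -/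
def energy (f : ℝ → WithTop ℂ) {N : ℕ} (z : Fin N → EuclideanSpace ℝ (Fin d)) : WithTop ℂ :=
  ∑ j : Fin N, ∑ k ∈ Finset.univ.erase j, f (Γ.geodesicDist (z j) (z k))

end RectifiableSimpleClosedCurve

/-- The complex values of a kernel `f` with values in `ℂ ∪ {+∞}` (with value `0` where `f` is
`+∞`). An admissible kernel is finite on `(0, L/2]`. -/
def kernelValue (f : ℝ → WithTop ℂ) (x : ℝ) : ℂ :=
  (f x).untopD 0

/-- `S_q(x) = ∑_{n=0}^q a_n x^{-s_n}`, with principal values of the powers. -/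
def powerSum {q : ℕ} (a s : Fin (q + 1) → ℂ) (x : ℝ) : ℂ :=
  ∑ n, a n * (x : ℂ) ^ (-s n)

/-- The kernel `f : [0, L/2] → ℂ ∪ {+∞}` (given as a function on `ℝ` of which only the values on
`[0, L/2]` matter) is admissible with the data `p`, `q`, `a_n`, `s_n`, `δ`. Derivatives on
`(0, L/2]` are one-sided at the end point `L/2`. -/
structure IsAdmissible (L : ℝ) (f : ℝ → WithTop ℂ) (p q : ℕ) (a s : Fin (q + 1) → ℂ) (δ : ℝ) :
    Prop where
  finite : ∀ x ∈ Ioc 0 (L / 2), f x ≠ ⊤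
  smooth : ContDiffOn ℝ (2 * p + 1 : ℕ) (kernelValue f) (Ioc 0 (L / 2))
  re_strictAnti : StrictAnti fun n => (s n).re
  last_exponent : 0 < (s (Fin.last q)).re + 2 * p ∨ s (Fin.last q) = -(2 * p : ℂ)
  delta_pos : 0 < δ
  delta_large : 0 < 1 - (s (Fin.last q)).re + δ
  integral_isBigO :
    (fun x : ℝ => ∫ y in (0 : ℝ)..x, (kernelValue f y - powerSum a s y)) =O[𝓝[>] 0]
      fun x : ℝ => x ^ (1 + δ - (s (Fin.last q)).re)
  deriv_isBigO : ∀ ν ≤ 2 * p + 1,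
    (fun x : ℝ => iteratedDerivWithin ν (fun y => kernelValue f y - powerSum a s y)
        (Ioc 0 (L / 2)) x) =O[𝓝[>] 0]
      fun x : ℝ => x ^ (δ - (s (Fin.last q)).re - ν)

/-- The coefficient `V_f` of `N²` on a curve of length `L`. -/
def leadingCoeff (L : ℝ) (f : ℝ → WithTop ℂ) {q : ℕ} (a s : Fin (q + 1) → ℂ) : ℂ :=
  2 / (L : ℂ) * ∑ n, a n * (((L : ℂ) / 2) ^ (1 - s n) / (1 - s n)) +
    2 / (L : ℂ) * ∫ x in (0 : ℝ)..(L / 2), (kernelValue f x - powerSum a s x)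

/-- The sum `B_p(Γ, f; N)` on a curve of length `L`, where `κ = N % 2`, i.e. `N = 2 M + κ` with
`κ ∈ {0, 1}`. -/
def bernoulliSum (L : ℝ) (f : ℝ → WithTop ℂ) (p N : ℕ) : ℂ :=
  2 / (L : ℂ) * (N : ℂ) ^ 2 *
    ∑ n ∈ Finset.Icc 1 p,
      (((Polynomial.bernoulli (2 * n)).eval (((N % 2 : ℕ) : ℚ) / 2) : ℚ) : ℂ) /
          ((2 * n).factorial : ℂ) *
        ((L : ℂ) / (N : ℂ)) ^ (2 * n) *
        iteratedDerivWithin (2 * n - 1) (kernelValue f) (Ioc 0 (L / 2)) (L / 2)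

end

/-! Arclength makes the curve a circle. Seen from any of the points, the distances to the others are
`h * min m (N - m)` for `1 ≤ m < N`, with `h = |Γ| / N`. The energy is therefore `2 * N` times
`cyclicHalfSum N` of `k ↦ f (h * k)` (`IsEquallySpaced.energy_eq`), and the curve plays no further
role.

This half sum runs over `1 ≤ k ≤ N / 2`, with half weight at `k = N / 2` when `N` is even. The
Euler-Maclaurin formula on `[1, N / 2]` (`euler_maclaurin_cyclicHalfSum`) applies. The right end is
an integer or a half-integer according to parity, which is where `B_{2n}(κ/2)` comes from. The left
end is `1` because the kernel may be singular at `0`.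

The kernel is split as `S_q + (f - S_q)`. For a power `x ^ (-s)`, the contributions of the left end,
together with the remainder integral extended to infinity, add up to `ζ(s)`. This is classical for
`Re s > 1` and extends by analytic continuation (`riemannZeta_eq`). Only the tail beyond `N / 2` is
left, and by homogeneity it costs `O(N^{1-2p})`.

For `f - S_q`, put `β = δ - Re s_q > -1`. The derivative of order `i` is `O(x^{β-i})` on all of `(0,
|Γ|/2]`, so the contributions of the left end are `O(h^β)`, and the remainder integral is at most a
constant times `h^β ∫_1^{N/2} x^{β-2p-1} dx` (`exists_bound_cyclicHalfSum_sub`). This gives `N^{-β}`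
and `N^{-2p}`, with a logarithm when `β = 2p`. `remainder_eq` assembles both parts. -/

noncomputable section

/-! ### Bernoulli polynomials and repeated integration by parts -/

/-- The Bernoulli polynomial divided by the factorial, `B_n(x) / n!`. -/
def scaledBernoulli (n : ℕ) (x : ℝ) : ℝ :=
  bernoulliFun n x / n.factorial

theorem continuous_scaledBernoulli (n : ℕ) : Continuous (scaledBernoulli n) :=
  (continuous_bernoulliFun n).div_const _

theorem hasDerivAt_scaledBernoulli_succ (n : ℕ) (x : ℝ) :
    HasDerivAt (scaledBernoulli (n + 1)) (scaledBernoulli n x) x := by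
  refine ((hasDerivAt_bernoulliFun (n + 1) x).div_const _).congr_deriv ?_
  have : (n.factorial : ℝ) ≠ 0 := by positivity
  have : ((n : ℝ) + 1) ≠ 0 := by positivity
  simp only [scaledBernoulli, Nat.factorial_succ, Nat.add_sub_cancel]
  push_cast
  field_simp

theorem scaledBernoulli_one_eq_zero {n : ℕ} (hn : n ≠ 1) :
    scaledBernoulli n 1 = scaledBernoulli n 0 := by
  simp only [scaledBernoulli, bernoulliFun_endpoints_eq_of_ne_one hn]

theorem scaledBernoulli_odd_zero {n : ℕ} (hn : 1 ≤ n) : scaledBernoulli (2 * n + 1) 0 = 0 := by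
  have h : bernoulli (2 * n + 1) = 0 :=
    bernoulli_eq_zero_of_odd (by exact odd_two_mul_add_one n) (by lia)
  simp [scaledBernoulli, bernoulliFun_eval_zero, h]

theorem scaledBernoulli_odd_half (n : ℕ) : scaledBernoulli (2 * n + 1) (1 / 2) = 0 := by
  simp [scaledBernoulli, bernoulliFun_eval_half_eq_zero]

/-- Repeated integration by parts against Bernoulli polynomials. -/
theorem integral_eq_sum_scaledBernoulli (m : ℕ) (D : ℕ → ℝ → ℂ) {c u v : ℝ} (huv : u ≤ v)
    (hcont : ∀ i ≤ m, ContinuousOn (D i) (Icc u v))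
    (hderiv : ∀ i < m, ∀ x ∈ Ioo u v, HasDerivAt (D i) (D (i + 1) x) x) :
    ∫ x in u..v, D 0 x =
      ∑ i ∈ Finset.range m, (-1 : ℂ) ^ i * (scaledBernoulli (i + 1) (v - c) * D i v -
        scaledBernoulli (i + 1) (u - c) * D i u) +
      (-1 : ℂ) ^ m * ∫ x in u..v, scaledBernoulli m (x - c) * D m x := by
  induction m with
  | zero => simp [scaledBernoulli]
  | succ m ih =>
    rw [ih (fun i hi => hcont i (by lia)) (fun i hi => hderiv i (by lia)), Finset.sum_range_succ]
    have hb : ∀ n, Continuous fun x : ℝ => (scaledBernoulli n (x - c) : ℂ) := fun n => by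
      have := continuous_scaledBernoulli n
      fun_prop
    have key := intervalIntegral.integral_mul_deriv_eq_deriv_mul_of_hasDerivAt
      (u := D m) (v := fun x : ℝ => (scaledBernoulli (m + 1) (x - c) : ℂ))
      (u' := D (m + 1)) (v' := fun x : ℝ => (scaledBernoulli m (x - c) : ℂ)) (a := u) (b := v)
      (by rw [uIcc_of_le huv]; exact hcont m (by lia)) (hb _).continuousOn
      (by rw [min_eq_left huv, max_eq_right huv]; exact hderiv m (by lia))
      (fun x _ => by
        have h1 := (hasDerivAt_scaledBernoulli_succ m (x - c)).comp x ((hasDerivAt_id x).sub_const c)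
        simpa using h1.ofReal_comp)
      (ContinuousOn.intervalIntegrable (by rw [uIcc_of_le huv]; exact hcont _ le_rfl))
      ((hb _).intervalIntegrable _ _)
    rw [intervalIntegral.integral_congr (g := fun x => D m x * (scaledBernoulli m (x - c) : ℂ))
      (fun x _ => mul_comm _ _), key,
      intervalIntegral.integral_congr (g := fun x => D (m + 1) x * (scaledBernoulli (m + 1) (x - c) : ℂ))
      (fun x _ => mul_comm _ _)]
    ring

/-- Pairs the boundary terms so that each `B_{2n}` stands next to `B_{2n+1}`, which vanishes at `0`,
`1/2` and `1` for `n ≥ 1`. The unpaired term `t 0` belongs to `B_1`. -/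
theorem sum_range_two_mul_add_one (p : ℕ) (t : ℕ → ℂ) :
    ∑ i ∈ Finset.range (2 * p + 1), t i =
      t 0 + ∑ n ∈ Finset.Icc 1 p, (t (2 * n - 1) + t (2 * n)) := by
  induction p with
  | zero => simp
  | succ p ih =>
    rw [show 2 * (p + 1) + 1 = 2 * p + 1 + 1 + 1 by ring, Finset.sum_range_succ,
      Finset.sum_range_succ, ih, Finset.sum_Icc_succ_top (by lia)]
    rw [show 2 * (p + 1) - 1 = 2 * p + 1 by lia, show 2 * (p + 1) = 2 * p + 1 + 1 by ring]
    ring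

/-! ### Euler-Maclaurin formulas -/

/-- The periodic Bernoulli function divided by the factorial. -/
def periodicBernoulli (n : ℕ) (x : ℝ) : ℝ :=
  scaledBernoulli n (Int.fract x)

theorem measurable_periodicBernoulli (n : ℕ) : Measurable (periodicBernoulli n) :=
  (continuous_scaledBernoulli n).measurable.comp measurable_fract

theorem exists_bound_periodicBernoulli (n : ℕ) :
    ∃ C : ℝ, 0 ≤ C ∧ ∀ x, |periodicBernoulli n x| ≤ C := by
  obtain ⟨C, hC⟩ := isCompact_Icc.exists_bound_of_continuousOn (s := Icc (0 : ℝ) 1)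
    (continuous_scaledBernoulli n).continuousOn
  refine ⟨C, (abs_nonneg _).trans (hC 0 (by simp)), fun x => ?_⟩
  exact hC _ ⟨Int.fract_nonneg x, (Int.fract_lt_one x).le⟩

theorem intervalIntegrable_periodicBernoulli_mul (n : ℕ) {g : ℝ → ℂ} {u v : ℝ} (huv : u ≤ v)
    (hg : ContinuousOn g (Icc u v)) :
    IntervalIntegrable (fun x => (periodicBernoulli n x : ℂ) * g x) volume u v := by
  obtain ⟨C, -, hC⟩ := exists_bound_periodicBernoulli n
  have h := (intervalIntegrable_iff_integrableOn_Ioc_of_le huv).1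
    (ContinuousOn.intervalIntegrable (μ := volume) (u := g) (a := u) (b := v)
      (by rwa [uIcc_of_le huv]))
  rw [intervalIntegrable_iff_integrableOn_Ioc_of_le huv]
  exact h.bdd_mul (c := C) (by
    exact (Complex.measurable_ofReal.comp (measurable_periodicBernoulli n)).aestronglyMeasurable)
    (Eventually.of_forall fun x => by simpa using hC x)

/-- On the open interval `Int.fract x = x - k`. This fails at `x = k + 1`, hence the passage from
`Ioc` to `Ioo`. -/
theorem integral_scaledBernoulli_sub_eq (n : ℕ) (g : ℝ → ℂ) {k : ℕ} {v : ℝ} (h1 : (k : ℝ) ≤ v)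
    (h2 : v ≤ k + 1) :
    ∫ x in (k : ℝ)..v, (scaledBernoulli n (x - k) : ℂ) * g x =
      ∫ x in (k : ℝ)..v, (periodicBernoulli n x : ℂ) * g x := by
  rw [intervalIntegral.integral_of_le h1, intervalIntegral.integral_of_le h1,
    integral_Ioc_eq_integral_Ioo, integral_Ioc_eq_integral_Ioo]
  refine setIntegral_congr_fun measurableSet_Ioo fun x hx => ?_
  have : Int.fract x = x - k := by
    rw [Int.fract_eq_iff]
    exact ⟨by linarith [hx.1], by linarith [hx.2], k, by simp⟩
  simp [periodicBernoulli, this]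

/-- The Euler-Maclaurin formula on a unit interval. -/
theorem euler_maclaurin_unit (p : ℕ) (D : ℕ → ℝ → ℂ) (k : ℕ)
    (hcont : ∀ i ≤ 2 * p + 1, ContinuousOn (D i) (Icc (k : ℝ) (k + 1)))
    (hderiv : ∀ i < 2 * p + 1, ∀ x ∈ Ioo (k : ℝ) (k + 1), HasDerivAt (D i) (D (i + 1) x) x) :
    (D 0 k + D 0 (k + 1)) / 2 = (∫ x in (k : ℝ)..(k + 1), D 0 x) +
      ∑ n ∈ Finset.Icc 1 p, scaledBernoulli (2 * n) 0 *
        (D (2 * n - 1) (k + 1) - D (2 * n - 1) k) +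
      ∫ x in (k : ℝ)..(k + 1), periodicBernoulli (2 * p + 1) x * D (2 * p + 1) x := by
  rw [integral_eq_sum_scaledBernoulli (c := k) (2 * p + 1) D (by linarith) hcont hderiv,
    sum_range_two_mul_add_one, integral_scaledBernoulli_sub_eq _ _ (by linarith) le_rfl]
  -- The `B_{2n+1}` terms vanish at both ends, and `B_{2n}` takes equal values there. The leftover
  -- `B_1` term, with values `1/2` and `-1/2`, is the trapezoidal mean.
  have : ∑ n ∈ Finset.Icc 1 p,
      ((-1 : ℂ) ^ (2 * n - 1) * (scaledBernoulli (2 * n - 1 + 1) (k + 1 - k) * D (2 * n - 1) (k + 1) -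
        scaledBernoulli (2 * n - 1 + 1) (k - k) * D (2 * n - 1) k) +
      (-1 : ℂ) ^ (2 * n) * (scaledBernoulli (2 * n + 1) (k + 1 - k) * D (2 * n) (k + 1) -
        scaledBernoulli (2 * n + 1) (k - k) * D (2 * n) k)) =
      - ∑ n ∈ Finset.Icc 1 p, scaledBernoulli (2 * n) 0 *
        (D (2 * n - 1) (k + 1) - D (2 * n - 1) k) := by
    rw [← Finset.sum_neg_distrib]
    refine Finset.sum_congr rfl fun n hn => ?_
    have hn1 := (Finset.mem_Icc.1 hn).1
    rw [(show Odd (2 * n - 1) from ⟨n - 1, by lia⟩).neg_one_pow, sub_self,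
      add_sub_cancel_left, scaledBernoulli_one_eq_zero (n := 2 * n + 1) (by lia),
      scaledBernoulli_odd_zero hn1, Nat.sub_add_cancel (by lia),
      scaledBernoulli_one_eq_zero (n := 2 * n) (by lia)]
    push_cast
    ring
  rw [this, (odd_two_mul_add_one p).neg_one_pow]
  simp [scaledBernoulli]
  ring

/-- The Euler-Maclaurin formula on half of a unit interval. -/
theorem euler_maclaurin_half (p : ℕ) (D : ℕ → ℝ → ℂ) (k : ℕ)
    (hcont : ∀ i ≤ 2 * p + 1, ContinuousOn (D i) (Icc (k : ℝ) (k + 1 / 2)))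
    (hderiv : ∀ i < 2 * p + 1, ∀ x ∈ Ioo (k : ℝ) (k + 1 / 2), HasDerivAt (D i) (D (i + 1) x) x) :
    D 0 k / 2 = (∫ x in (k : ℝ)..(k + 1 / 2), D 0 x) +
      ∑ n ∈ Finset.Icc 1 p, (scaledBernoulli (2 * n) (1 / 2) * D (2 * n - 1) (k + 1 / 2) -
        scaledBernoulli (2 * n) 0 * D (2 * n - 1) k) +
      ∫ x in (k : ℝ)..(k + 1 / 2), periodicBernoulli (2 * p + 1) x * D (2 * p + 1) x := by
  rw [integral_eq_sum_scaledBernoulli (c := k) (2 * p + 1) D (by linarith) hcont hderiv,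
    sum_range_two_mul_add_one, integral_scaledBernoulli_sub_eq _ _ (by linarith) (by linarith)]
  -- All odd Bernoulli polynomials vanish at `1/2`. In particular `B_1(1/2) = 0`, so the value of `D
  -- 0` at the midpoint gets no weight.
  have : ∑ n ∈ Finset.Icc 1 p,
      ((-1 : ℂ) ^ (2 * n - 1) * (scaledBernoulli (2 * n - 1 + 1) (k + 1 / 2 - k) *
        D (2 * n - 1) (k + 1 / 2) - scaledBernoulli (2 * n - 1 + 1) (k - k) * D (2 * n - 1) k) +
      (-1 : ℂ) ^ (2 * n) * (scaledBernoulli (2 * n + 1) (k + 1 / 2 - k) * D (2 * n) (k + 1 / 2) -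
        scaledBernoulli (2 * n + 1) (k - k) * D (2 * n) k)) =
      - ∑ n ∈ Finset.Icc 1 p, (scaledBernoulli (2 * n) (1 / 2) * D (2 * n - 1) (k + 1 / 2) -
        scaledBernoulli (2 * n) 0 * D (2 * n - 1) k) := by
    rw [← Finset.sum_neg_distrib]
    refine Finset.sum_congr rfl fun n hn => ?_
    have hn1 := (Finset.mem_Icc.1 hn).1
    rw [(show Odd (2 * n - 1) from ⟨n - 1, by lia⟩).neg_one_pow, sub_self,
      add_sub_cancel_left, scaledBernoulli_odd_half,
      scaledBernoulli_odd_zero hn1, Nat.sub_add_cancel (by lia)]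
    push_cast
    ring
  rw [this, (odd_two_mul_add_one p).neg_one_pow]
  simp [scaledBernoulli]
  ring

/-- Unit intervals are glued together; since `B_{2n}(1) = B_{2n}(0)`, the boundary terms at interior
integers telescope. -/
theorem euler_maclaurin_nat (p : ℕ) (D : ℕ → ℝ → ℂ) {M : ℕ} (hM : 1 ≤ M)
    (hcont : ∀ i ≤ 2 * p + 1, ContinuousOn (D i) (Icc 1 (M : ℝ)))
    (hderiv : ∀ i < 2 * p + 1, ∀ x ∈ Ioo 1 (M : ℝ), HasDerivAt (D i) (D (i + 1) x) x) :
    ∑ k ∈ Finset.Icc 1 M, D 0 k - D 0 M / 2 = (∫ x in (1 : ℝ)..M, D 0 x) + D 0 1 / 2 +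
      ∑ n ∈ Finset.Icc 1 p, (scaledBernoulli (2 * n) 0 * D (2 * n - 1) M -
        scaledBernoulli (2 * n) 0 * D (2 * n - 1) 1) +
      ∫ x in (1 : ℝ)..M, periodicBernoulli (2 * p + 1) x * D (2 * p + 1) x := by
  induction M, hM using Nat.le_induction with
  | base => simp; ring
  | succ M hM ih =>
    have hM' : (1 : ℝ) ≤ M := by exact_mod_cast hM
    push_cast at hcont hderiv ⊢
    have hI : ∀ g : ℝ → ℂ, IntervalIntegrable g volume 1 (M + 1) →
        ∫ x in (1 : ℝ)..(M + 1), g x = (∫ x in (1 : ℝ)..M, g x) + ∫ x in (M : ℝ)..(M + 1), g x := by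
      intro g hg
      rw [intervalIntegral.integral_add_adjacent_intervals] <;> apply hg.mono_set <;>
        rw [uIcc_of_le (by linarith), uIcc_of_le (by linarith)] <;>
        apply Icc_subset_Icc <;> linarith
    rw [hI _ (ContinuousOn.intervalIntegrable (by
        rw [uIcc_of_le (by linarith)]; exact hcont 0 (by lia))),
      hI _ (intervalIntegrable_periodicBernoulli_mul _ (by linarith) (hcont _ le_rfl))]
    have h1 := ih (fun i hi => (hcont i hi).mono (Icc_subset_Icc_right (by linarith)))
      (fun i hi x hx => hderiv i hi x (Ioo_subset_Ioo_right (by linarith) hx))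
    have h2 := euler_maclaurin_unit p D M
      (fun i hi => (hcont i hi).mono (Icc_subset_Icc_left (by linarith)))
      (fun i hi x hx => hderiv i hi x (Ioo_subset_Ioo_left (by linarith) hx))
    rw [Finset.sum_Icc_succ_top (by lia)]
    simp only [mul_sub, Finset.sum_sub_distrib] at h1 h2 ⊢
    push_cast
    linear_combination h1 + h2

/-- One half interval is appended to `[1, M]`. It supplies the missing half of `D 0 M` and moves the
boundary terms from `M` to `M + 1/2`, with `B_{2n}(1/2)` in place of `B_{2n}(0)`. -/
theorem euler_maclaurin_nat_add_half (p : ℕ) (D : ℕ → ℝ → ℂ) {M : ℕ} (hM : 1 ≤ M)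
    (hcont : ∀ i ≤ 2 * p + 1, ContinuousOn (D i) (Icc 1 (M + 1 / 2 : ℝ)))
    (hderiv : ∀ i < 2 * p + 1, ∀ x ∈ Ioo 1 (M + 1 / 2 : ℝ), HasDerivAt (D i) (D (i + 1) x) x) :
    ∑ k ∈ Finset.Icc 1 M, D 0 k = (∫ x in (1 : ℝ)..(M + 1 / 2), D 0 x) + D 0 1 / 2 +
      ∑ n ∈ Finset.Icc 1 p, (scaledBernoulli (2 * n) (1 / 2) * D (2 * n - 1) (M + 1 / 2) -
        scaledBernoulli (2 * n) 0 * D (2 * n - 1) 1) +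
      ∫ x in (1 : ℝ)..(M + 1 / 2), periodicBernoulli (2 * p + 1) x * D (2 * p + 1) x := by
  have hM' : (1 : ℝ) ≤ M := by exact_mod_cast hM
  have hI : ∀ g : ℝ → ℂ, IntervalIntegrable g volume 1 (M + 1 / 2) →
      ∫ x in (1 : ℝ)..(M + 1 / 2), g x =
        (∫ x in (1 : ℝ)..M, g x) + ∫ x in (M : ℝ)..(M + 1 / 2), g x := by
    intro g hg
    rw [intervalIntegral.integral_add_adjacent_intervals] <;> apply hg.mono_set <;>
      rw [uIcc_of_le (by linarith), uIcc_of_le (by linarith)] <;>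
      apply Icc_subset_Icc <;> linarith
  rw [hI _ (ContinuousOn.intervalIntegrable (by
      rw [uIcc_of_le (by linarith)]; exact hcont 0 (by lia))),
    hI _ (intervalIntegrable_periodicBernoulli_mul _ (by linarith) (hcont _ le_rfl))]
  have h1 := euler_maclaurin_nat p D hM
    (fun i hi => (hcont i hi).mono (Icc_subset_Icc_right (by linarith)))
    (fun i hi x hx => hderiv i hi x (Ioo_subset_Ioo_right (by linarith) hx))
  have h2 := euler_maclaurin_half p D M
    (fun i hi => (hcont i hi).mono (Icc_subset_Icc_left (by linarith)))
    (fun i hi x hx => hderiv i hi x (Ioo_subset_Ioo_left (by linarith) hx))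
  simp only [Finset.sum_sub_distrib] at h1 h2 ⊢
  linear_combination h1 + h2

/-! ### Sums over the distances in a cycle -/

/-- Half of the sum over the nonzero residues mod `N` of a function of their distance to `0`. -/
def cyclicHalfSum (N : ℕ) (F : ℕ → ℂ) : ℂ :=
  (∑ m ∈ Finset.Ico 1 N, F (min m (N - m))) / 2

/-- The residues above `N / 2` are reflected by `m ↦ N - m`. The middle residue of an even `N` is
its own reflection and occurs only in the first sum. -/
theorem sum_Ico_min_eq (F : ℕ → ℂ) (N : ℕ) :
    ∑ m ∈ Finset.Ico 1 N, F (min m (N - m)) =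
      ∑ m ∈ Finset.Icc 1 (N / 2), F m + ∑ m ∈ Finset.Icc 1 ((N - 1) / 2), F m := by
  rw [← Finset.sum_filter_add_sum_filter_not (Finset.Ico 1 N) (fun m => m ≤ N / 2)]
  congr 1
  · refine Finset.sum_bij' (fun m _ => m) (fun m _ => m) ?_ ?_ ?_ ?_ ?_ <;>
      simp only [Finset.mem_filter, Finset.mem_Ico, Finset.mem_Icc] <;> intros <;>
      first | rfl | lia
  · refine Finset.sum_bij' (fun m _ => N - m) (fun m _ => N - m) ?_ ?_ ?_ ?_ ?_ <;>
      simp only [Finset.mem_filter, Finset.mem_Ico, Finset.mem_Icc] <;> intros <;>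
      lia

/-- The Euler-Maclaurin formula for `cyclicHalfSum`. -/
theorem euler_maclaurin_cyclicHalfSum (p : ℕ) (D : ℕ → ℝ → ℂ) {N : ℕ} (hN : 2 ≤ N)
    (hcont : ∀ i ≤ 2 * p + 1, ContinuousOn (D i) (Icc 1 (N / 2 : ℝ)))
    (hderiv : ∀ i < 2 * p + 1, ∀ x ∈ Ioo 1 (N / 2 : ℝ), HasDerivAt (D i) (D (i + 1) x) x) :
    cyclicHalfSum N (fun k => D 0 k) = (∫ x in (1 : ℝ)..(N / 2), D 0 x) + D 0 1 / 2 +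
      ∑ n ∈ Finset.Icc 1 p,
        (scaledBernoulli (2 * n) ((N % 2 : ℕ) / 2) * D (2 * n - 1) (N / 2) -
        scaledBernoulli (2 * n) 0 * D (2 * n - 1) 1) +
      ∫ x in (1 : ℝ)..(N / 2), periodicBernoulli (2 * p + 1) x * D (2 * p + 1) x := by
  rw [cyclicHalfSum, sum_Ico_min_eq (fun k => D 0 k)]
  rcases Nat.even_or_odd' N with ⟨M, rfl | rfl⟩
  · obtain ⟨K, rfl⟩ : ∃ K, M = K + 1 := ⟨M - 1, by lia⟩
    have e : ((2 * (K + 1) : ℕ) / 2 : ℝ) = (K + 1 : ℕ) := by push_cast; ring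
    rw [e] at hcont hderiv ⊢
    have h := euler_maclaurin_nat p D (by lia) hcont hderiv
    -- The two sums end at `K + 1` and at `K`, so their mean has half weight at the last point, as
    -- in the trapezoidal rule.
    rw [show 2 * (K + 1) / 2 = K + 1 by lia, show (2 * (K + 1) - 1) / 2 = K by lia,
      show 2 * (K + 1) % 2 = 0 by lia]
    simp only [Nat.cast_zero, zero_div]
    rw [← h, Finset.sum_Icc_succ_top (by lia)]
    ring
  · have e : ((2 * M + 1 : ℕ) / 2 : ℝ) = M + 1 / 2 := by push_cast; ring
    rw [e] at hcont hderiv ⊢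
    have h := euler_maclaurin_nat_add_half p D (by lia) hcont hderiv
    rw [show (2 * M + 1) / 2 = M by lia, show (2 * M + 1 - 1) / 2 = M by lia,
      show (2 * M + 1) % 2 = 1 by lia]
    simp only [Nat.cast_one]
    rw [← h]
    ring

/-! ### Derivatives of complex powers -/

/-- The `i`-th derivative of `x ↦ x ^ (-s)`. -/
def powDeriv (s : ℂ) (i : ℕ) (x : ℝ) : ℂ :=
  (∏ j ∈ Finset.range i, (-s - j)) * (x : ℂ) ^ (-s - i)

theorem powDeriv_zero (s : ℂ) (x : ℝ) : powDeriv s 0 x = (x : ℂ) ^ (-s) := by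
  simp [powDeriv]

theorem powDeriv_one_right (s : ℂ) (i : ℕ) :
    powDeriv s i 1 = ∏ j ∈ Finset.range i, (-s - j) := by
  simp [powDeriv]

theorem hasDerivAt_powDeriv (s : ℂ) (i : ℕ) {x : ℝ} (hx : 0 < x) :
    HasDerivAt (powDeriv s i) (powDeriv s (i + 1) x) x := by
  have h := ((hasDerivAt_id (x : ℂ)).cpow_const (c := -s - i)
    (Complex.ofReal_mem_slitPlane.2 hx)).comp_ofReal
  refine (h.const_mul (∏ j ∈ Finset.range i, (-s - j))).congr_deriv ?_
  rw [powDeriv, Finset.prod_range_succ]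
  push_cast
  simp only [id, mul_one]
  rw [show -s - ((i : ℂ) + 1) = -s - i - 1 by ring]
  ring

theorem continuousOn_powDeriv (s : ℂ) (i : ℕ) : ContinuousOn (powDeriv s i) (Ioi 0) :=
  fun _ hx => (hasDerivAt_powDeriv s i hx).continuousAt.continuousWithinAt

theorem norm_powDeriv (s : ℂ) (i : ℕ) {x : ℝ} (hx : 0 < x) :
    ‖powDeriv s i x‖ = ‖∏ j ∈ Finset.range i, (-s - j)‖ * x ^ (-s.re - i) := by
  rw [powDeriv, norm_mul, Complex.norm_cpow_eq_rpow_re_of_pos hx]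
  simp

/-- Homogeneity of the power: this moves between the variable `h * x` of the kernel and the integer
variable of the sums. -/
theorem powDeriv_mul (s : ℂ) (i : ℕ) {h x : ℝ} (hh : 0 < h) (hx : 0 < x) :
    (h : ℂ) ^ i * powDeriv s i (h * x) = (h : ℂ) ^ (-s) * powDeriv s i x := by
  have h0 : (h : ℂ) ≠ 0 := by exact_mod_cast hh.ne'
  rw [powDeriv, powDeriv, Complex.ofReal_mul, Complex.mul_cpow_ofReal_nonneg hh.le hx.le,
    Complex.cpow_sub _ _ h0, Complex.cpow_natCast]
  field_simp

theorem tendsto_powDeriv_natCast (s : ℂ) (i : ℕ) (hs : 0 < s.re) :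
    Tendsto (fun M : ℕ => powDeriv s i M) atTop (𝓝 0) := by
  rw [tendsto_zero_iff_norm_tendsto_zero]
  have h := ((tendsto_rpow_neg_atTop (y := s.re + i) (by positivity)).comp
    (tendsto_natCast_atTop_atTop (R := ℝ))).const_mul ‖∏ j ∈ Finset.range i, (-s - j)‖
  rw [mul_zero] at h
  refine h.congr' ?_
  filter_upwards [eventually_gt_atTop 0] with M hM
  rw [norm_powDeriv _ _ (by exact_mod_cast hM)]
  simp [sub_eq_add_neg, add_comm]

/-! ### The Riemann zeta function through Euler-Maclaurin -/

/-- The integral of the Euler-Maclaurin remainder of order `m` of `ζ`, up to a factor. -/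
def zetaTail (m : ℕ) (s : ℂ) : ℂ :=
  ∫ x in Ioi (1 : ℝ), (periodicBernoulli m x : ℂ) * (x : ℂ) ^ (-s - m)

theorem integrableOn_periodicBernoulli_mul_cpow (m : ℕ) {s : ℂ} {X : ℝ} (hX : 0 < X)
    (hs : 1 < s.re + m) :
    IntegrableOn (fun x : ℝ => (periodicBernoulli m x : ℂ) * (x : ℂ) ^ (-s - m)) (Ioi X) := by
  obtain ⟨C, -, hC⟩ := exists_bound_periodicBernoulli m
  refine Integrable.bdd_mul (c := C)
    (integrableOn_Ioi_cpow_of_lt (by simp; linarith) hX)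
    (Complex.measurable_ofReal.comp (measurable_periodicBernoulli m)).aestronglyMeasurable
    (Eventually.of_forall fun x => by simpa using hC x)

/-- The integral is the Mellin transform, at `1 - s - m`, of a bounded function cut off to `(1, ∞)`.
Such a transform is holomorphic where its argument has negative real part. -/
theorem differentiableAt_zetaTail (m : ℕ) {s : ℂ} (hs : 1 < s.re + m) :
    DifferentiableAt ℂ (zetaTail m) s := by
  set F : ℝ → ℂ := (Ioi 1).indicator fun x => (periodicBernoulli m x : ℂ) with hF
  obtain ⟨C, -, hC⟩ := exists_bound_periodicBernoulli m
  have hFb : ∀ x, ‖F x‖ ≤ C := fun x => by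
    refine (norm_indicator_le_norm_self _ _).trans ?_
    simpa using hC x
  have hFm : Measurable F :=
    (Complex.measurable_ofReal.comp (measurable_periodicBernoulli m)).indicator measurableSet_Ioi
  have heq : zetaTail m = fun s => mellin F (1 - s - m) := by
    funext s
    rw [zetaTail, mellin, ← integral_indicator measurableSet_Ioi,
      ← integral_indicator measurableSet_Ioi]
    congr 1
    funext x
    by_cases hx : x ∈ Ioi (1 : ℝ)
    · have hx0 : x ∈ Ioi (0 : ℝ) := mem_Ioi.2 (one_pos.trans (mem_Ioi.1 hx))
      rw [indicator_of_mem hx, indicator_of_mem hx0, hF, indicator_of_mem hx, smul_eq_mul, mul_comm]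
      congr 2
      ring
    · rw [indicator_of_notMem hx]
      by_cases hx0 : x ∈ Ioi (0 : ℝ)
      · rw [indicator_of_mem hx0, hF, indicator_of_notMem hx, smul_zero]
      · rw [indicator_of_notMem hx0]
  have hd : DifferentiableAt ℂ (mellin F) (1 - s - m) := by
    -- `a = 0` expresses boundedness at infinity. As `F` vanishes near `0`, any `b` below the real
    -- part of the argument serves.
    refine mellin_differentiableAt_of_isBigO_rpow (a := 0) (b := (1 - s - m).re - 1) ?_ ?_ ?_ ?_ ?_
    · refine LocallyIntegrable.locallyIntegrableOn (fun x => ?_) _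
      obtain ⟨u, hu, hui⟩ := (locallyIntegrable_const (μ := volume) C) x
      exact ⟨u, hu, Integrable.mono' hui hFm.aestronglyMeasurable (Eventually.of_forall hFb)⟩
    · refine IsBigO.of_bound C (Eventually.of_forall fun x => ?_)
      simpa using hFb x
    · simp; linarith
    · refine IsBigO.of_bound 1 ?_
      filter_upwards [Ioo_mem_nhdsGT (one_pos (α := ℝ))] with x hx
      rw [hF, indicator_of_notMem (by simpa using hx.2.le)]
      simp
    · linarith
  rw [heq]
  exact DifferentiableAt.comp (g := mellin F) (f := fun s : ℂ => 1 - s - m) s hd (by fun_prop)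

/-- The regular part of the Euler-Maclaurin expression for `ζ`. -/
def zetaRegular (p : ℕ) (s : ℂ) : ℂ :=
  1 / 2 - ∑ n ∈ Finset.Icc 1 p, scaledBernoulli (2 * n) 0 * powDeriv s (2 * n - 1) 1 +
    (∏ j ∈ Finset.range (2 * p + 1), (-s - j)) * zetaTail (2 * p + 1) s

theorem differentiableAt_zetaRegular (p : ℕ) {s : ℂ} (hs : -(2 * p : ℝ) < s.re) :
    DifferentiableAt ℂ (zetaRegular p) s := by
  have h := differentiableAt_zetaTail (2 * p + 1) (s := s) (by push_cast; linarith)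
  unfold zetaRegular
  simp only [powDeriv_one_right]
  have hprod : ∀ i, DifferentiableAt ℂ (fun s : ℂ => ∏ j ∈ Finset.range i, (-s - j)) s := by
    intro i
    fun_prop
  refine ((differentiableAt_const _).sub ?_).add ((hprod _).mul h)
  exact DifferentiableAt.fun_sum fun n _ => (hprod _).const_mul _

theorem integral_Ioi_periodicBernoulli_mul_powDeriv (m : ℕ) (s : ℂ) (X : ℝ) :
    ∫ x in Ioi X, (periodicBernoulli m x : ℂ) * powDeriv s m x =
      (∏ j ∈ Finset.range m, (-s - j)) *
        ∫ x in Ioi X, (periodicBernoulli m x : ℂ) * (x : ℂ) ^ (-s - m) := by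
  rw [← integral_const_mul]
  congr 1
  funext x
  rw [powDeriv]
  ring

/-- Let `M → ∞` in `euler_maclaurin_nat` for `x ^ (-s)`: the boundary terms at `M` die out and both
integrals converge. -/
theorem riemannZeta_eq_of_one_lt_re (p : ℕ) {s : ℂ} (hs : 1 < s.re) :
    riemannZeta s = 1 / (s - 1) + zetaRegular p s := by
  have hs1 : s - 1 ≠ 0 := fun h => by
    rw [sub_eq_zero] at h
    simp [h] at hs
  have hsum : Tendsto (fun M : ℕ => ∑ k ∈ Finset.Icc 1 M, powDeriv s 0 k) atTop
      (𝓝 (riemannZeta s)) := by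
    have h1 : Summable fun n : ℕ => 1 / ((n : ℂ) + 1) ^ s := by
      have := (summable_nat_add_iff 1).2 (Complex.summable_one_div_nat_cpow.2 hs)
      simpa using this
    rw [zeta_eq_tsum_one_div_nat_add_one_cpow hs]
    refine h1.hasSum.tendsto_sum_nat.congr fun M => ?_
    rw [← Finset.Ico_add_one_right_eq_Icc, Finset.sum_Ico_eq_sum_range, Nat.add_sub_cancel]
    refine Finset.sum_congr rfl fun n _ => ?_
    rw [powDeriv_zero, Complex.cpow_neg, one_div]
    push_cast
    rw [add_comm]
  have hpos : ∀ M : ℝ, Icc 1 M ⊆ Ioi 0 := fun M x hx => lt_of_lt_of_le one_pos hx.1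
  have hEM : ∀ᶠ M : ℕ in atTop, ∑ k ∈ Finset.Icc 1 M, powDeriv s 0 k - powDeriv s 0 M / 2 =
      (∫ x in (1 : ℝ)..M, powDeriv s 0 x) + powDeriv s 0 1 / 2 +
      ∑ n ∈ Finset.Icc 1 p, (scaledBernoulli (2 * n) 0 * powDeriv s (2 * n - 1) M -
        scaledBernoulli (2 * n) 0 * powDeriv s (2 * n - 1) 1) +
      ∫ x in (1 : ℝ)..M, periodicBernoulli (2 * p + 1) x * powDeriv s (2 * p + 1) x := by
    filter_upwards [eventually_ge_atTop 1] with M hM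
    exact euler_maclaurin_nat p (powDeriv s) hM
      (fun i _ => (continuousOn_powDeriv s i).mono (hpos _))
      (fun i _ x hx => hasDerivAt_powDeriv s i (lt_trans one_pos hx.1))
  have h0 := tendsto_powDeriv_natCast s
  have hl := hsum.sub ((h0 0 (by linarith)).div_const 2)
  have hint1 : Tendsto (fun M : ℕ => ∫ x in (1 : ℝ)..M, powDeriv s 0 x) atTop
      (𝓝 (1 / (s - 1))) := by
    have h1 := intervalIntegral_tendsto_integral_Ioi (1 : ℝ)
      (integrableOn_Ioi_cpow_of_lt (a := -s) (by simpa using hs) one_pos)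
      (tendsto_natCast_atTop_atTop (R := ℝ))
    rw [integral_Ioi_cpow_of_lt (by simpa using hs) one_pos] at h1
    simp only [powDeriv_zero]
    convert h1 using 2
    rw [Complex.ofReal_one, Complex.one_cpow, neg_div, ← div_neg]
    congr 1
    ring
  have hint2 : Tendsto (fun M : ℕ => ∫ x in (1 : ℝ)..M,
      (periodicBernoulli (2 * p + 1) x : ℂ) * powDeriv s (2 * p + 1) x) atTop
      (𝓝 ((∏ j ∈ Finset.range (2 * p + 1), (-s - j)) * zetaTail (2 * p + 1) s)) := by
    rw [zetaTail, ← integral_Ioi_periodicBernoulli_mul_powDeriv]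
    refine intervalIntegral_tendsto_integral_Ioi (1 : ℝ) ?_ (tendsto_natCast_atTop_atTop (R := ℝ))
    have := (integrableOn_periodicBernoulli_mul_cpow (2 * p + 1) (s := s) one_pos
      (by push_cast; linarith [Nat.cast_nonneg (α := ℝ) p])).const_mul
      (∏ j ∈ Finset.range (2 * p + 1), (-s - j))
    refine this.congr (Eventually.of_forall fun x => ?_)
    simp only [powDeriv]
    ring
  have hr := ((hint1.add_const (powDeriv s 0 1 / 2)).add (tendsto_finsetSum (Finset.Icc 1 p)
    fun n _ => ((h0 (2 * n - 1) (by linarith)).const_mul (scaledBernoulli (2 * n) 0 : ℂ)).sub_const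
      (scaledBernoulli (2 * n) 0 * powDeriv s (2 * n - 1) 1))).add hint2
  have := tendsto_nhds_unique (hl.congr' hEM) hr
  simp only [mul_zero, zero_sub, zero_div, sub_zero, Finset.sum_neg_distrib] at this
  rw [this, zetaRegular, powDeriv_zero]
  simp
  ring

/-- The Euler-Maclaurin expression for `ζ` in the half plane `-2p < Re s`. -/
theorem riemannZeta_eq_of_lt_re (p : ℕ) {s : ℂ} (hs : -(2 * p : ℝ) < s.re) (hs1 : s ≠ 1) :
    riemannZeta s = 1 / (s - 1) + zetaRegular p s := by
  set U : Set ℂ := {z | -(2 * p : ℝ) < z.re} with hU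
  have hUo : IsOpen U := isOpen_lt continuous_const Complex.continuous_re
  have hUc : IsPreconnected U := (convex_halfSpace_re_gt _).isPreconnected
  -- Multiplication by `z - 1` removes the pole of `ζ`; the value `1` filled in at `z = 1` is the
  -- residue.
  set A : ℂ → ℂ := Function.update (fun z => (z - 1) * riemannZeta z) 1 1 with hA
  have hAn : AnalyticOnNhd ℂ A U := by
    refine DifferentiableOn.analyticOnNhd (DifferentiableOn.mono ?_ (subset_univ U)) hUo
    refine (Complex.differentiableOn_compl_singleton_and_continuousAt_iff (c := (1 : ℂ))
      univ_mem).1 ⟨?_, continuousAt_update_same.2 riemannZeta_residue_one⟩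
    intro z hz
    have hz1 : z ≠ 1 := hz.2
    have : DifferentiableAt ℂ (fun z => (z - 1) * riemannZeta z) z :=
      (by fun_prop : DifferentiableAt ℂ (fun z : ℂ => z - 1) z).mul (differentiableAt_riemannZeta hz1)
    refine (this.congr_of_eventuallyEq ?_).differentiableWithinAt
    filter_upwards [isOpen_compl_singleton.mem_nhds hz1] with w hw
    rw [hA, Function.update_of_ne hw]
  have hB : AnalyticOnNhd ℂ (fun z => 1 + (z - 1) * zetaRegular p z) U := by
    refine DifferentiableOn.analyticOnNhd (fun z hz => DifferentiableAt.differentiableWithinAt ?_) hUo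
    have := differentiableAt_zetaRegular p hz
    fun_prop
  have hmem : (2 : ℂ) ∈ U := by
    have : (0 : ℝ) ≤ p := Nat.cast_nonneg p
    rw [hU, mem_ofPred_eq, Complex.re_ofNat]
    linarith
  -- Identity theorem on the half plane: the two sides agree near `2`, where the series
  -- representation holds.
  have heq := hAn.eqOn_of_preconnected_of_eventuallyEq hB hUc hmem (by
    filter_upwards [(isOpen_lt continuous_const Complex.continuous_re).mem_nhds
      (show (1 : ℝ) < (2 : ℂ).re by simp)] with z hz
    have hz1 : z ≠ 1 := fun h => by simp [h] at hz
    have hz1' := sub_ne_zero.2 hz1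
    rw [hA, Function.update_of_ne hz1, riemannZeta_eq_of_one_lt_re p hz]
    field_simp) hs
  have h1 := sub_ne_zero.2 hs1
  rw [hA, Function.update_of_ne hs1] at heq
  field_simp
  linear_combination heq

/-- For `s = -2p` the power `x ^ (-s)` is the monomial `x ^ (2p)`, whose derivative of order `2p +
1` vanishes. So the boundary exponent leaves no remainder integral. -/
theorem prod_range_eq_zero_of_eq_neg (p : ℕ) :
    ∏ j ∈ Finset.range (2 * p + 1), (-(-(2 * p : ℂ)) - j) = 0 :=
  Finset.prod_eq_zero (i := 2 * p) (by simp) (by push_cast; ring)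

/-- The Euler-Maclaurin expression for `ζ`, including the boundary exponent `-2p`. -/
theorem riemannZeta_eq (p : ℕ) {s : ℂ} (hs : 0 < s.re + 2 * p ∨ s = -(2 * p : ℂ)) (hs1 : s ≠ 1) :
    riemannZeta s = 1 / (s - 1) + zetaRegular p s := by
  rcases hs with hs | rfl
  · exact riemannZeta_eq_of_lt_re p (by linarith) hs1
  -- The point `-2p` is interior to the half plane for `p + 1`. The additional Bernoulli term and
  -- both remainder terms contain the factor that vanishes.
  · rw [riemannZeta_eq_of_lt_re (p + 1) (by simp) hs1]
    have h0 := prod_range_eq_zero_of_eq_neg p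
    have h1 : powDeriv (-(2 * p : ℂ)) (2 * (p + 1) - 1) 1 = 0 := by
      rw [powDeriv_one_right, show 2 * (p + 1) - 1 = 2 * p + 1 by lia, h0]
    rw [zetaRegular, zetaRegular, Finset.sum_Icc_succ_top (by lia), h1, h0,
      Finset.prod_eq_zero (i := 2 * p) (by simp) (by push_cast; ring)]
    simp

/-! ### Cyclic sums of powers -/

/-- The terms of Euler-Maclaurin at `x = 1` are those in the expression for `ζ(s)`. Completing the
remainder integral from `[1, N/2]` to `(1, ∞)` produces `ζ(s)` itself and the subtracted tail. -/
theorem cyclicHalfSum_powDeriv_eq (p : ℕ) {s : ℂ} (hs : 0 < s.re + 2 * p ∨ s = -(2 * p : ℂ))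
    (hs1 : s ≠ 1) {N : ℕ} (hN : 2 ≤ N) :
    cyclicHalfSum N (fun k => powDeriv s 0 k) =
      ((N / 2 : ℝ) : ℂ) ^ (1 - s) / (1 - s) + riemannZeta s +
        ∑ n ∈ Finset.Icc 1 p, scaledBernoulli (2 * n) ((N % 2 : ℕ) / 2) *
          powDeriv s (2 * n - 1) (N / 2) -
        ∫ x in Ioi (N / 2 : ℝ), periodicBernoulli (2 * p + 1) x * powDeriv s (2 * p + 1) x := by
  have hX : (1 : ℝ) ≤ N / 2 := by
    have : (2 : ℝ) ≤ N := by exact_mod_cast hN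
    linarith
  have hsub : Icc 1 (N / 2 : ℝ) ⊆ Ioi 0 := fun x hx => lt_of_lt_of_le one_pos hx.1
  have h1s : 1 - s ≠ 0 := sub_ne_zero.2 hs1.symm
  have hs1' : s - 1 ≠ 0 := sub_ne_zero.2 hs1
  have hint : ∫ x in (1 : ℝ)..(N / 2), powDeriv s 0 x =
      (((N / 2 : ℝ) : ℂ) ^ (1 - s) - 1) / (1 - s) := by
    simp only [powDeriv_zero]
    rw [integral_cpow (Or.inr ⟨fun h => hs1 (neg_injective h), by
      rw [uIcc_of_le hX]; exact fun h => lt_irrefl (0 : ℝ) (mem_Ioi.1 (hsub h))⟩)]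
    rw [show -s + 1 = 1 - s by ring]
    simp
  have htail : (∏ j ∈ Finset.range (2 * p + 1), (-s - j)) * zetaTail (2 * p + 1) s =
      (∫ x in (1 : ℝ)..(N / 2), periodicBernoulli (2 * p + 1) x * powDeriv s (2 * p + 1) x) +
      ∫ x in Ioi (N / 2 : ℝ), periodicBernoulli (2 * p + 1) x * powDeriv s (2 * p + 1) x := by
    rw [zetaTail, ← integral_Ioi_periodicBernoulli_mul_powDeriv]
    rcases hs with hs | rfl
    · rw [intervalIntegral.integral_interval_add_Ioi]
      · have := (integrableOn_periodicBernoulli_mul_cpow (2 * p + 1) (s := s) one_pos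
          (by push_cast; linarith)).const_mul (∏ j ∈ Finset.range (2 * p + 1), (-s - j))
        refine this.congr (Eventually.of_forall fun x => ?_)
        simp only [powDeriv]
        ring
      · have := (integrableOn_periodicBernoulli_mul_cpow (2 * p + 1) (s := s)
          (lt_of_lt_of_le one_pos hX) (by push_cast; linarith)).const_mul
          (∏ j ∈ Finset.range (2 * p + 1), (-s - j))
        refine this.congr (Eventually.of_forall fun x => ?_)
        simp only [powDeriv]
        ring
    -- For `s = -2p` the derivative in the integrands is zero, so no question of convergence arises.
    · simp only [powDeriv, prod_range_eq_zero_of_eq_neg]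
      simp
  rw [euler_maclaurin_cyclicHalfSum p (powDeriv s) hN
    (fun i _ => (continuousOn_powDeriv s i).mono hsub)
    (fun i _ x hx => hasDerivAt_powDeriv s i (lt_trans one_pos hx.1)), hint,
    riemannZeta_eq p hs hs1, zetaRegular, htail, powDeriv_zero]
  simp only [Finset.sum_sub_distrib, Complex.ofReal_one, Complex.one_cpow]
  rw [show (1 : ℂ) / (s - 1) = -1 / (1 - s) by rw [← neg_sub 1 s, div_neg, neg_div]]
  ring

/-- The periodic Bernoulli function is bounded, and the derivative of order `2p + 1` is a multiple
of a power of modulus `x ^ (-Re s - 2p - 1)`, integrable at infinity if `Re s + 2p > 0`. -/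
theorem exists_bound_integral_Ioi_periodicBernoulli (p : ℕ) {s : ℂ}
    (hs : 0 < s.re + 2 * p ∨ s = -(2 * p : ℂ)) :
    ∃ K : ℝ, 0 ≤ K ∧ ∀ N : ℕ, 2 ≤ N →
      ‖∫ x in Ioi (N / 2 : ℝ), periodicBernoulli (2 * p + 1) x * powDeriv s (2 * p + 1) x‖ ≤
        K * (N : ℝ) ^ (-s.re - 2 * p) := by
  rcases hs with hs | rfl
  · obtain ⟨C, hC0, hC⟩ := exists_bound_periodicBernoulli (2 * p + 1)
    set c := ‖∏ j ∈ Finset.range (2 * p + 1), (-s - j)‖ with hc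
    refine ⟨C * c * ((2 : ℝ)⁻¹ ^ (-s.re - 2 * p) / (s.re + 2 * p)), by positivity, fun N hN => ?_⟩
    have hN0 : (0 : ℝ) < N := by exact_mod_cast (by lia : 0 < N)
    have hX : (0 : ℝ) < N / 2 := by positivity
    have hlt : -s.re - (2 * p + 1 : ℕ) < -1 := by push_cast; linarith
    have hb := norm_integral_le_of_norm_le (μ := volume.restrict (Ioi (N / 2 : ℝ)))
      (f := fun x => (periodicBernoulli (2 * p + 1) x : ℂ) * powDeriv s (2 * p + 1) x)
      ((integrableOn_Ioi_rpow_of_lt hlt hX).const_mul (C * c)) (by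
        filter_upwards [ae_restrict_mem measurableSet_Ioi] with x hx
        rw [norm_mul, norm_powDeriv _ _ (hX.trans hx), mul_assoc C]
        exact mul_le_mul_of_nonneg_right (by simpa using hC x)
          (mul_nonneg (norm_nonneg _) (Real.rpow_nonneg (hX.trans hx).le _)))
    refine hb.trans (le_of_eq ?_)
    rw [integral_const_mul, integral_Ioi_rpow_of_lt hlt hX,
      show -s.re - (2 * p + 1 : ℕ) + 1 = -s.re - 2 * p by push_cast; ring, div_eq_mul_inv (N : ℝ) 2,
      Real.mul_rpow hN0.le (by norm_num), show s.re + 2 * p = -(-s.re - 2 * p) by ring]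
    rw [div_neg, neg_div]
    ring
  · refine ⟨0, le_rfl, fun N _ => ?_⟩
    simp only [powDeriv, prod_range_eq_zero_of_eq_neg]
    simp

/-! ### Cyclic sums of a function of power growth at the origin -/

/-- The discretization error for a function with the growth of `x ^ β` at `0`, where `β > -1`. -/
theorem exists_bound_cyclicHalfSum_sub (p : ℕ) (G : ℕ → ℝ → ℂ) {L β K : ℝ} (hL : 0 < L)
    (hβ : -1 < β) (hK : 0 ≤ K)
    (hcont : ∀ i ≤ 2 * p + 1, ContinuousOn (G i) (Ioc 0 (L / 2)))
    (hderiv : ∀ i < 2 * p + 1, ∀ x ∈ Ioo 0 (L / 2), HasDerivAt (G i) (G (i + 1) x) x)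
    (hbound : ∀ i ≤ 2 * p + 1, ∀ x ∈ Ioc 0 (L / 2), ‖G i x‖ ≤ K * x ^ (β - i))
    (hint : IntervalIntegrable (G 0) volume 0 (L / 2)) :
    ∃ K' : ℝ, 0 ≤ K' ∧ ∀ N : ℕ, 2 ≤ N →
      ‖cyclicHalfSum N (fun k => G 0 (L / N * k)) - (((L / N : ℝ) : ℂ)⁻¹ * ∫ x in (0 : ℝ)..(L / 2), G 0 x) -
        ∑ n ∈ Finset.Icc 1 p, scaledBernoulli (2 * n) ((N % 2 : ℕ) / 2) *
          (((L / N : ℝ) : ℂ) ^ (2 * n - 1) * G (2 * n - 1) (L / 2))‖ ≤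
      K' * ((N : ℝ) ^ (-β) * (1 + ∫ x in (1 : ℝ)..(N / 2), x ^ (β - (2 * p + 1 : ℕ)))) := by
  obtain ⟨C, hC0, hC⟩ := exists_bound_periodicBernoulli (2 * p + 1)
  set S := ∑ n ∈ Finset.Icc 1 p, |scaledBernoulli (2 * n) 0| with hS
  have hS0 : 0 ≤ S := Finset.sum_nonneg fun _ _ => abs_nonneg _
  have hβ1 : 0 < β + 1 := by linarith
  -- The four summands bound, in this order, the integral over `(0, h)`, the half value at `h`, the
  -- Bernoulli terms at `h` and the remainder integral (`hb1` to `hb4`).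
  refine ⟨L ^ β * (K * (1 / (β + 1) + 1 / 2 + S + C)), by positivity, fun N hN => ?_⟩
  have hN2 : (2 : ℝ) ≤ N := by exact_mod_cast hN
  have hN0 : (0 : ℝ) < N := by linarith
  set h : ℝ := L / N with hh
  have hh0 : 0 < h := by positivity
  have hhc : (h : ℂ) ≠ 0 := by exact_mod_cast hh0.ne'
  have hX : (1 : ℝ) ≤ N / 2 := by linarith
  have hhN : h * (N / 2) = L / 2 := by rw [hh]; field_simp
  have hhL : h ≤ L / 2 := by rw [← hhN]; nlinarith
  have hmaps : MapsTo (fun x => h * x) (Icc 1 (N / 2 : ℝ)) (Ioc 0 (L / 2)) := fun x hx =>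
    ⟨by have := hx.1; positivity, by rw [← hhN]; exact mul_le_mul_of_nonneg_left hx.2 hh0.le⟩
  have hsc : ∀ i : ℕ, ∀ x : ℝ, 0 < x → h ^ i * (h * x) ^ (β - i) = h ^ β * x ^ (β - i) := by
    intro i x hx
    rw [Real.mul_rpow hh0.le hx.le, Real.rpow_sub hh0, Real.rpow_natCast]
    field_simp
  -- After rescaling, the factor `h ^ i` of the chain rule turns the bounds of every order into one
  -- common factor `h ^ β`.
  have hD : ∀ i ≤ 2 * p + 1, ∀ x ∈ Icc 1 (N / 2 : ℝ),
      ‖(h : ℂ) ^ i * G i (h * x)‖ ≤ K * (h ^ β * x ^ (β - i)) := by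
    intro i hi x hx
    rw [← hsc i x (by linarith [hx.1]), norm_mul, norm_pow, Complex.norm_real, Real.norm_of_nonneg hh0.le]
    calc h ^ i * ‖G i (h * x)‖ ≤ h ^ i * (K * (h * x) ^ (β - i)) :=
          mul_le_mul_of_nonneg_left (hbound i hi _ (hmaps hx)) (by positivity)
      _ = _ := by ring
  have hEM := euler_maclaurin_cyclicHalfSum p (fun i x => (h : ℂ) ^ i * G i (h * x)) hN
    (fun i hi => continuousOn_const.mul ((hcont i hi).comp (by fun_prop) hmaps))
    (fun i hi x hx => by
      have hx' : h * x ∈ Ioo 0 (L / 2) :=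
        ⟨by have := hx.1; positivity, by rw [← hhN]; exact mul_lt_mul_of_pos_left hx.2 hh0⟩
      have h1 : HasDerivAt (fun x : ℝ => h * x) h x := by
        simpa using (hasDerivAt_id x).const_mul h
      refine (((hderiv i hi _ hx').scomp x h1).const_mul ((h : ℂ) ^ i)).congr_deriv ?_
      rw [Complex.real_smul]
      ring)
  simp only [pow_zero, one_mul, hhN, mul_one, Finset.sum_sub_distrib] at hEM
  rw [hEM]
  -- Euler-Maclaurin starts at `x = 1`, that is at `h`; the missing integral over `(0, h)` is
  -- restored here and becomes part of the error.
  have hmain : ∫ x in (1 : ℝ)..(N / 2), G 0 (h * x) =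
      (h : ℂ)⁻¹ * (∫ x in (0 : ℝ)..(L / 2), G 0 x) - (h : ℂ)⁻¹ * ∫ x in (0 : ℝ)..h, G 0 x := by
    rw [intervalIntegral.integral_comp_mul_left _ hh0.ne', hhN, mul_one, ← mul_sub,
      intervalIntegral.integral_interval_sub_left hint, Complex.real_smul, Complex.ofReal_inv]
    refine hint.mono_set ?_
    rw [uIcc_of_le hh0.le, uIcc_of_le (by positivity)]
    exact Icc_subset_Icc_right hhL
  have hb1 : ‖(h : ℂ)⁻¹ * ∫ x in (0 : ℝ)..h, G 0 x‖ ≤ h ^ β * (K * (1 / (β + 1))) := by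
    have := intervalIntegral.norm_integral_le_of_norm_le (μ := volume) (f := G 0)
      (g := fun x => K * x ^ β) hh0.le (Eventually.of_forall fun x hx => by
        simpa using hbound 0 (by lia) x ⟨hx.1, hx.2.trans hhL⟩)
      ((intervalIntegral.intervalIntegrable_rpow' hβ).const_mul K)
    rw [intervalIntegral.integral_const_mul, integral_rpow (Or.inl hβ),
      Real.zero_rpow hβ1.ne', Real.rpow_add_one hh0.ne'] at this
    rw [norm_mul, norm_inv, Complex.norm_real, Real.norm_of_nonneg hh0.le]
    calc _ ≤ h⁻¹ * _ := mul_le_mul_of_nonneg_left this (by positivity)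
      _ = _ := by field_simp; ring
  have h1mem : (1 : ℝ) ∈ Icc 1 (N / 2 : ℝ) := ⟨le_rfl, hX⟩
  have hb2 : ‖G 0 h / 2‖ ≤ h ^ β * (K * (1 / 2)) := by
    have := hD 0 (by lia) 1 h1mem
    simp only [pow_zero, one_mul, mul_one, Real.one_rpow] at this
    rw [norm_div, Complex.norm_ofNat]
    linarith
  have hb3 : ‖∑ n ∈ Finset.Icc 1 p, (scaledBernoulli (2 * n) 0 : ℂ) *
      ((h : ℂ) ^ (2 * n - 1) * G (2 * n - 1) h)‖ ≤ h ^ β * (K * S) := by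
    rw [hS, Finset.mul_sum, Finset.mul_sum]
    refine norm_sum_le_of_le _ fun n hn => ?_
    have hn' := (Finset.mem_Icc.1 hn).2
    have := hD (2 * n - 1) (by lia) 1 h1mem
    simp only [mul_one, Real.one_rpow] at this
    rw [norm_mul, Complex.norm_real, Real.norm_eq_abs]
    calc _ ≤ |scaledBernoulli (2 * n) 0| * (K * h ^ β) :=
          mul_le_mul_of_nonneg_left this (abs_nonneg _)
      _ = _ := by ring
  set J := ∫ x in (1 : ℝ)..(N / 2), x ^ (β - (2 * p + 1 : ℕ)) with hJ
  have hJ0 : 0 ≤ J := intervalIntegral.integral_nonneg hX fun x hx =>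
    Real.rpow_nonneg (by linarith [hx.1]) _
  have hb4 : ‖∫ x in (1 : ℝ)..(N / 2), (periodicBernoulli (2 * p + 1) x : ℂ) *
      ((h : ℂ) ^ (2 * p + 1) * G (2 * p + 1) (h * x))‖ ≤ h ^ β * (K * C) * J := by
    have h0 : (0 : ℝ) ∉ uIcc 1 (N / 2 : ℝ) := by
      rw [uIcc_of_le hX]; exact fun h => absurd h.1 (by norm_num)
    rw [hJ, ← intervalIntegral.integral_const_mul]
    refine intervalIntegral.norm_integral_le_of_norm_le hX (Eventually.of_forall fun x hx => ?_)
      ((intervalIntegral.intervalIntegrable_rpow (Or.inr h0)).const_mul _)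
    have hx' : x ∈ Icc 1 (N / 2 : ℝ) := ⟨hx.1.le, hx.2⟩
    rw [norm_mul]
    calc _ ≤ C * (K * (h ^ β * x ^ (β - (2 * p + 1 : ℕ)))) :=
          mul_le_mul (by simpa using hC x) (hD _ le_rfl x hx') (norm_nonneg _) hC0
      _ = _ := by ring
  have hhβ : h ^ β = L ^ β * (N : ℝ) ^ (-β) := by
    rw [hh, Real.div_rpow hL.le hN0.le, Real.rpow_neg hN0.le, div_eq_mul_inv]
  have hhβ0 : 0 ≤ h ^ β := by positivity
  rw [hmain]
  calc _ = ‖-((h : ℂ)⁻¹ * ∫ x in (0 : ℝ)..h, G 0 x) + G 0 h / 2 -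
        (∑ n ∈ Finset.Icc 1 p, (scaledBernoulli (2 * n) 0 : ℂ) *
          ((h : ℂ) ^ (2 * n - 1) * G (2 * n - 1) h)) +
        ∫ x in (1 : ℝ)..(N / 2), (periodicBernoulli (2 * p + 1) x : ℂ) *
          ((h : ℂ) ^ (2 * p + 1) * G (2 * p + 1) (h * x))‖ := by
        congr 1; ring
    _ ≤ h ^ β * (K * (1 / (β + 1))) + h ^ β * (K * (1 / 2)) + h ^ β * (K * S) +
        h ^ β * (K * C) * J := by
        refine (norm_add_le _ _).trans (add_le_add ((norm_sub_le _ _).trans (add_le_add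
          ((norm_add_le _ _).trans (add_le_add ?_ hb2)) hb3)) hb4)
        rwa [norm_neg]
    _ ≤ h ^ β * (K * (1 / (β + 1) + 1 / 2 + S + C)) * (1 + J) := by
        have e1 : 0 ≤ h ^ β * (K * (1 / (β + 1) + 1 / 2 + S)) * J := by positivity
        have e2 : 0 ≤ h ^ β * (K * C) := by positivity
        nlinarith
    _ = _ := by rw [hhβ]; ring

/-- The exponent under the integral is not `-1`, so the integral is `((N/2)^{β-2p} - 1) / (β - 2p)`.
Passing to absolute values treats both signs of `β - 2p` at once. -/
theorem exists_bound_rpow_mul_one_add_integral {β : ℝ} {p : ℕ} (h : (2 * p : ℝ) ≠ β) :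
    ∃ K : ℝ, 0 ≤ K ∧ ∀ N : ℕ, 2 ≤ N →
      (N : ℝ) ^ (-β) * (1 + ∫ x in (1 : ℝ)..(N / 2), x ^ (β - (2 * p + 1 : ℕ))) ≤
        K * ((N : ℝ) ^ (-(2 * p) : ℝ) + (N : ℝ) ^ (-β)) := by
  have hne : β - 2 * p ≠ 0 := sub_ne_zero.2 h.symm
  have hpos : 0 < |β - 2 * p| := abs_pos.2 hne
  refine ⟨1 + (2⁻¹ ^ (β - 2 * p) + 1) / |β - 2 * p|, by positivity, fun N hN => ?_⟩
  have hN2 : (2 : ℝ) ≤ N := by exact_mod_cast hN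
  have hN0 : (0 : ℝ) < N := by linarith
  have hX : (1 : ℝ) ≤ N / 2 := by linarith
  rw [integral_rpow (Or.inr ⟨fun h' => hne (by push_cast at h'; linarith), by
    rw [uIcc_of_le hX]; exact fun h => absurd h.1 (by norm_num)⟩),
    show β - (2 * p + 1 : ℕ) + 1 = β - 2 * p by push_cast; ring, Real.one_rpow]
  set A : ℝ := 2⁻¹ ^ (β - 2 * p) with hA
  have hA0 : 0 < A := by positivity
  have h1 : ((N / 2 : ℝ) ^ (β - 2 * p) - 1) / (β - 2 * p) ≤
      ((N / 2 : ℝ) ^ (β - 2 * p) + 1) / |β - 2 * p| := by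
    refine (le_abs_self _).trans ?_
    rw [abs_div]
    gcongr
    refine (abs_sub _ _).trans ?_
    rw [abs_one, abs_of_nonneg (by positivity)]
  have h2 : (N : ℝ) ^ (-β) * (N / 2 : ℝ) ^ (β - 2 * p) = A * (N : ℝ) ^ (-(2 * p) : ℝ) := by
    rw [div_eq_mul_inv, Real.mul_rpow hN0.le (by norm_num), ← mul_assoc, ← Real.rpow_add hN0, hA,
      mul_comm]
    congr 2
    ring
  set P : ℝ := (N : ℝ) ^ (-(2 * p) : ℝ)
  set Q : ℝ := (N : ℝ) ^ (-β)
  have hP : 0 ≤ P := by positivity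
  have hQ : 0 ≤ Q := by positivity
  calc _ ≤ Q * (1 + ((N / 2 : ℝ) ^ (β - 2 * p) + 1) / |β - 2 * p|) := by gcongr
    _ = Q + (A * P + Q) / |β - 2 * p| := by rw [← h2]; ring
    -- The added nonnegative terms complete the numerator to `(A + 1) * (P + Q)`.
    _ ≤ (P + Q) + (A * P + Q + (P + A * Q)) / |β - 2 * p| := by
        have := mul_nonneg hA0.le hQ
        exact add_le_add (by linarith) (div_le_div_of_nonneg_right (by linarith) hpos.le)
    _ = _ := by ring

/-- The exponent is exactly `-1`, so the integral is a logarithm; the summand `1` is absorbed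
because `log N ≥ log 2`. -/
theorem exists_bound_rpow_mul_one_add_integral_of_eq {β : ℝ} {p : ℕ} (h : (2 * p : ℝ) = β) :
    ∃ K : ℝ, 0 ≤ K ∧ ∀ N : ℕ, 2 ≤ N →
      (N : ℝ) ^ (-β) * (1 + ∫ x in (1 : ℝ)..(N / 2), x ^ (β - (2 * p + 1 : ℕ))) ≤
        K * ((N : ℝ) ^ (-(2 * p) : ℝ) * Real.log N) := by
  have hl2 : 0 < Real.log 2 := Real.log_pos (by norm_num)
  refine ⟨1 / Real.log 2 + 1, by positivity, fun N hN => ?_⟩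
  have hN2 : (2 : ℝ) ≤ N := by exact_mod_cast hN
  have hN0 : (0 : ℝ) < N := by linarith
  have hX : (1 : ℝ) ≤ N / 2 := by linarith
  have e : ∫ x in (1 : ℝ)..(N / 2), x ^ (β - (2 * p + 1 : ℕ)) = Real.log (N / 2) := by
    have : ∀ x : ℝ, x ^ (β - (2 * p + 1 : ℕ)) = x⁻¹ := fun x => by
      rw [← h, show (2 * p - (2 * p + 1 : ℕ) : ℝ) = -1 by push_cast; ring, Real.rpow_neg_one]
    simp only [this]
    rw [integral_inv_of_pos one_pos (by linarith), div_one]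
  rw [e, h, mul_left_comm]
  have h1 : Real.log (N / 2) ≤ Real.log N := Real.log_le_log (by linarith) (by linarith)
  have h2 : Real.log 2 ≤ Real.log N := Real.log_le_log (by norm_num) hN2
  have h3 : 1 ≤ 1 / Real.log 2 * Real.log N := by
    rw [one_div_mul_eq_div, le_div_iff₀ hl2]; linarith
  refine mul_le_mul_of_nonneg_left ?_ (by positivity)
  linarith

/-! ### Arclength geometry of equally spaced points -/

namespace RectifiableSimpleClosedCurve

variable {d : ℕ} (Γ : RectifiableSimpleClosedCurve d)

theorem eVariationOn_ne_top {t u : ℝ} (ht : 0 ≤ t) (hu : u ≤ 1) :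
    eVariationOn Γ.toFun (Icc t u) ≠ ⊤ :=
  ne_top_of_le_ne_top Γ.rectifiable (eVariationOn.mono _ (Icc_subset_Icc ht hu))

theorem pieceLength_nonneg (t u : ℝ) : 0 ≤ Γ.pieceLength t u :=
  ENNReal.toReal_nonneg

theorem pieceLength_add {t u v : ℝ} (ht : 0 ≤ t) (htu : t ≤ u) (huv : u ≤ v) (hv : v ≤ 1) :
    Γ.pieceLength t u + Γ.pieceLength u v = Γ.pieceLength t v := by
  rw [pieceLength, pieceLength, pieceLength, ← ENNReal.toReal_add
    (Γ.eVariationOn_ne_top ht (huv.trans hv)) (Γ.eVariationOn_ne_top (ht.trans htu) hv)]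
  have := eVariationOn.Icc_add_Icc Γ.toFun (s := univ) htu huv (mem_univ u)
  simp only [univ_inter] at this
  rw [this]

theorem length_pos : 0 < Γ.length := by
  refine ENNReal.toReal_pos (fun h => ?_) Γ.rectifiable
  have h0 := (eVariationOn.eq_zero_iff Γ.toFun).1 h 0 (by simp) (1 / 2) (by norm_num)
  have := Γ.simple (by simp) (by norm_num) (edist_eq_zero.1 h0)
  norm_num at this

theorem param_mem {x : EuclideanSpace ℝ (Fin d)} (hx : x ∈ Γ.carrier) :
    Γ.param x ∈ Ico (0 : ℝ) 1 := by
  refine Function.invFunOn_mem ?_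
  obtain ⟨t, ht, rfl⟩ := hx
  rcases eq_or_lt_of_le ht.2 with rfl | h
  · exact ⟨0, by simp, Γ.closed⟩
  · exact ⟨t, ⟨ht.1, h⟩, rfl⟩

theorem arcLength_mem {x y : EuclideanSpace ℝ (Fin d)} (hx : x ∈ Γ.carrier) (hy : y ∈ Γ.carrier) :
    Γ.arcLength x y ∈ Icc 0 Γ.length := by
  have hx' := Γ.param_mem hx
  have hy' := Γ.param_mem hy
  have e := fun t : ℝ => fun h : t ∈ Ico (0 : ℝ) 1 => Γ.pieceLength_add le_rfl h.1 h.2.le le_rfl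
  have hex := e _ hx'
  have hey := e _ hy'
  have p1 := Γ.pieceLength_nonneg 0 (Γ.param x)
  have p2 := Γ.pieceLength_nonneg (Γ.param y) 1
  have p3 := Γ.pieceLength_nonneg (Γ.param x) 1
  have p4 := Γ.pieceLength_nonneg 0 (Γ.param y)
  rw [arcLength, length]
  split_ifs with h
  · have h1 := Γ.pieceLength_add le_rfl hx'.1 h hy'.2.le
    exact ⟨Γ.pieceLength_nonneg _ _, by linarith⟩
  · push Not at h
    have h1 := Γ.pieceLength_add le_rfl hy'.1 h.le hx'.2.le
    have h2 := Γ.pieceLength_nonneg (Γ.param y) (Γ.param x)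
    exact ⟨by linarith, by linarith⟩

/-- `pieceLength 0 (param x)` is the arclength coordinate of `x` on a circle of circumference `|Γ|`.
Working modulo `|Γ|` removes the case distinction in `arcLength` when arcs are added. -/
theorem arcLength_eq_sub_add {x y : EuclideanSpace ℝ (Fin d)} (hx : x ∈ Γ.carrier)
    (hy : y ∈ Γ.carrier) : ∃ i : ℤ, Γ.arcLength x y =
      Γ.pieceLength 0 (Γ.param y) - Γ.pieceLength 0 (Γ.param x) + i * Γ.length := by
  have hx' := Γ.param_mem hx
  have hy' := Γ.param_mem hy
  rw [arcLength]
  split_ifs with h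
  · have h1 := Γ.pieceLength_add le_rfl hx'.1 h hy'.2.le
    exact ⟨0, by push_cast; linarith⟩
  · have h1 := Γ.pieceLength_add le_rfl hx'.1 hx'.2.le le_rfl
    exact ⟨1, by rw [length]; push_cast; linarith⟩

variable {N : ℕ} {z : Fin N → EuclideanSpace ℝ (Fin d)}

theorem IsEquallySpaced.exists_pieceLength_eq {Γ : RectifiableSimpleClosedCurve d}
    (hz : Γ.IsEquallySpaced z) (h0 : 0 < N) (j : ℕ) (hj : j < N) : ∃ i : ℤ,
      Γ.pieceLength 0 (Γ.param (z ⟨j, hj⟩)) = Γ.pieceLength 0 (Γ.param (z ⟨0, h0⟩)) +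
        j * (Γ.length / N) + i * Γ.length := by
  induction j with
  | zero => exact ⟨0, by simp⟩
  | succ j ih =>
    obtain ⟨i, hi⟩ := ih (by lia)
    obtain ⟨i', hi'⟩ := Γ.arcLength_eq_sub_add (hz.1 ⟨j, by lia⟩) (hz.1 ⟨j + 1, hj⟩)
    rw [hz.2 ⟨j, by lia⟩ ⟨j + 1, hj⟩ rfl] at hi'
    refine ⟨i - i', ?_⟩
    push_cast
    linarith

/-- Both arcs are known modulo `|Γ|` and lie in `[0, |Γ|]`. The asserted values lie strictly between
`0` and `|Γ|`, so no other representative is possible. -/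
theorem IsEquallySpaced.arcLength_eq_of_lt {Γ : RectifiableSimpleClosedCurve d}
    (hz : Γ.IsEquallySpaced z) {j k : Fin N} (hjk : j < k) :
    Γ.arcLength (z j) (z k) = ((k : ℕ) - (j : ℕ) : ℕ) * (Γ.length / N) ∧
    Γ.arcLength (z k) (z j) = (N - ((k : ℕ) - (j : ℕ)) : ℕ) * (Γ.length / N) := by
  have hL := Γ.length_pos
  have hk := k.2
  have hjk' : (j : ℕ) < k := hjk
  have hN : (0 : ℝ) < N := by exact_mod_cast (by lia : 0 < N)
  obtain ⟨i₁, h₁⟩ := hz.exists_pieceLength_eq (by lia) j j.2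
  obtain ⟨i₂, h₂⟩ := hz.exists_pieceLength_eq (by lia) k k.2
  obtain ⟨i₃, h₃⟩ := Γ.arcLength_eq_sub_add (hz.1 j) (hz.1 k)
  obtain ⟨i₄, h₄⟩ := Γ.arcLength_eq_sub_add (hz.1 k) (hz.1 j)
  simp only [Fin.eta] at h₁ h₂
  have m₃ := Γ.arcLength_mem (hz.1 j) (hz.1 k)
  have m₄ := Γ.arcLength_mem (hz.1 k) (hz.1 j)
  set L := Γ.length
  have key : ∀ (m : ℕ) (a : ℝ) (i : ℤ), 0 < m → m < N → a ∈ Icc 0 L →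
      a = m * (L / N) + i * L → a = m * (L / N) := by
    intro m a i hm0 hmN ha hai
    have hm0' : (0 : ℝ) < m := by exact_mod_cast hm0
    have hmN' : (m : ℝ) < N := by exact_mod_cast hmN
    have hlt : m * (L / N) < L := by
      rw [mul_div_assoc', div_lt_iff₀ hN]; nlinarith
    have hgt : 0 < m * (L / N) := by positivity
    have h1 : (i : ℝ) < 1 := by
      by_contra h
      push Not at h
      nlinarith [ha.2]
    have h2 : (-1 : ℝ) < i := by
      by_contra h
      push Not at h
      nlinarith [ha.1]
    have h1' : i < 1 := by exact_mod_cast h1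
    have h2' : -1 < i := by exact_mod_cast h2
    obtain rfl : i = 0 := by lia
    simpa using hai
  have hcast : (((k : ℕ) - (j : ℕ) : ℕ) : ℝ) = (k : ℕ) - (j : ℕ) := Nat.cast_sub hjk'.le
  have hcast' : ((N - ((k : ℕ) - (j : ℕ)) : ℕ) : ℝ) = N - ((k : ℕ) - (j : ℕ)) := by
    rw [Nat.cast_sub (by lia), hcast]
  -- The way back is congruent to `-(k - j)` steps; writing it as `N - (k - j)` steps uses one full
  -- turn, hence the `- 1`.
  refine ⟨key _ _ (i₂ - i₁ + i₃) (by lia) (by lia) m₃ ?_,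
    key _ _ (i₁ - i₂ + i₄ - 1) (by lia) (by lia) m₄ ?_⟩
  · rw [hcast, h₃, h₁, h₂]
    push_cast
    ring
  · rw [hcast', h₄, h₁, h₂]
    push_cast
    field_simp
    ring

theorem geodesicDist_comm (x y : EuclideanSpace ℝ (Fin d)) :
    Γ.geodesicDist x y = Γ.geodesicDist y x :=
  min_comm _ _

theorem IsEquallySpaced.geodesicDist_eq_of_lt {Γ : RectifiableSimpleClosedCurve d}
    (hz : Γ.IsEquallySpaced z) {j k : Fin N} (hjk : j < k) :
    Γ.geodesicDist (z j) (z k) = Γ.length / N *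
      (min ((k : ℕ) - (j : ℕ)) (N - ((k : ℕ) - (j : ℕ))) : ℕ) := by
  obtain ⟨h₁, h₂⟩ := hz.arcLength_eq_of_lt hjk
  have hL := Γ.length_pos
  rw [geodesicDist, h₁, h₂, ← min_mul_of_nonneg _ _ (by positivity), Nat.cast_min, mul_comm]

/-- The points are reindexed by the residue `m` of `k - j` modulo `N`; adding `N` first keeps the
natural subtraction exact. -/
theorem IsEquallySpaced.sum_geodesicDist {α : Type*} [AddCommMonoid α]
    {Γ : RectifiableSimpleClosedCurve d}
    (hz : Γ.IsEquallySpaced z) (F : ℝ → α) (j : Fin N) :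
    ∑ k ∈ Finset.univ.erase j, F (Γ.geodesicDist (z j) (z k)) =
      ∑ m ∈ Finset.Ico 1 N, F (Γ.length / N * (min m (N - m) : ℕ)) := by
  have hj := j.2
  refine Finset.sum_bij' (fun k _ => ((k : ℕ) + N - j) % N)
    (fun m _ => ⟨((j : ℕ) + m) % N, Nat.mod_lt _ (by lia)⟩) ?_ ?_ ?_ ?_ ?_
  · intro k hk
    have hk' : (k : ℕ) ≠ j := fun h => (Finset.ne_of_mem_erase hk) (Fin.ext h)
    have := k.2
    rw [Finset.mem_Ico]
    rcases lt_or_gt_of_ne hk' with h | h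
    · rw [Nat.mod_eq_of_lt (by lia)]; lia
    · rw [show (k : ℕ) + N - j = k - j + N by lia, Nat.add_mod_right, Nat.mod_eq_of_lt (by lia)]; lia
  · intro m hm
    rw [Finset.mem_Ico] at hm
    refine Finset.mem_erase.2 ⟨fun h => ?_, Finset.mem_univ _⟩
    have h' : ((j : ℕ) + m) % N = j := congrArg Fin.val h
    rcases lt_or_ge ((j : ℕ) + m) N with h1 | h1
    · rw [Nat.mod_eq_of_lt h1] at h'; lia
    · rw [Nat.mod_eq_sub_mod h1, Nat.mod_eq_of_lt (by lia)] at h'; lia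
  · intro k hk
    have := k.2
    refine Fin.ext ?_
    change ((j : ℕ) + ((k : ℕ) + N - j) % N) % N = k
    rw [Nat.add_mod_mod, show (j : ℕ) + ((k : ℕ) + N - j) = k + N by lia, Nat.add_mod_right,
      Nat.mod_eq_of_lt this]
  · intro m hm
    rw [Finset.mem_Ico] at hm
    change (((j : ℕ) + m) % N + N - j) % N = m
    rcases lt_or_ge ((j : ℕ) + m) N with h1 | h1
    · rw [Nat.mod_eq_of_lt h1, show (j : ℕ) + m + N - j = m + N by lia, Nat.add_mod_right,
        Nat.mod_eq_of_lt hm.2]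
    · rw [Nat.mod_eq_sub_mod h1, Nat.mod_eq_of_lt (by lia : (j : ℕ) + m - N < N),
        Nat.mod_eq_of_lt (by lia)]
      lia
  · intro k hk
    have hk' : (k : ℕ) ≠ j := fun h => (Finset.ne_of_mem_erase hk) (Fin.ext h)
    have := k.2
    rcases lt_or_gt_of_ne hk' with h | h
    · rw [Γ.geodesicDist_comm, hz.geodesicDist_eq_of_lt (show k < j from h),
        Nat.mod_eq_of_lt (by lia)]
      congr 3
      lia
    · rw [hz.geodesicDist_eq_of_lt (show j < k from h), show (k : ℕ) + N - j = k - j + N by lia,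
        Nat.add_mod_right, Nat.mod_eq_of_lt (by lia)]

/-- Every distance that occurs lies in `(0, |Γ|/2]`, where `f` is finite, so the sum can be taken in
`ℂ`. All `N` inner sums coincide, and the factor `2` undoes the halving in `cyclicHalfSum`. -/
theorem IsEquallySpaced.energy_eq {Γ : RectifiableSimpleClosedCurve d}
    (hz : Γ.IsEquallySpaced z) (f : ℝ → WithTop ℂ)
    (hf : ∀ x ∈ Ioc 0 (Γ.length / 2), f x ≠ ⊤) :
    Γ.energy f z =
      ((2 * N * cyclicHalfSum N (fun k => kernelValue f (Γ.length / N * k)) : ℂ) : WithTop ℂ) := by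
  have hL := Γ.length_pos
  have h1 : ∀ j : Fin N, ∑ k ∈ Finset.univ.erase j, f (Γ.geodesicDist (z j) (z k)) =
      ((∑ m ∈ Finset.Ico 1 N, kernelValue f (Γ.length / N * (min m (N - m) : ℕ)) : ℂ) :
        WithTop ℂ) := by
    intro j
    rw [hz.sum_geodesicDist f j, WithTop.coe_sum]
    refine Finset.sum_congr rfl fun m hm => ?_
    rw [Finset.mem_Ico] at hm
    have hN : (0 : ℝ) < N := by exact_mod_cast (by lia : 0 < N)
    have hcoe : ∀ w : WithTop ℂ, w ≠ ⊤ → w = (w.untopD 0 : ℂ) := fun w hw => by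
      lift w to ℂ using hw
      rfl
    refine hcoe _ (hf _ ⟨?_, ?_⟩)
    · have : (0 : ℝ) < (min m (N - m) : ℕ) := by exact_mod_cast (by lia : 0 < min m (N - m))
      positivity
    · have : (2 * (min m (N - m) : ℕ) : ℝ) ≤ N := by
        exact_mod_cast (by lia : 2 * min m (N - m) ≤ N)
      rw [div_mul_eq_mul_div, div_le_div_iff₀ hN two_pos]
      nlinarith
  rw [energy, Finset.sum_congr rfl fun j _ => h1 j, ← WithTop.coe_sum, cyclicHalfSum,
    Finset.sum_const, Finset.card_univ, Fintype.card_fin, nsmul_eq_mul]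
  congr 1
  ring

end RectifiableSimpleClosedCurve

/-! ### Admissible kernels -/

/-- Near `0` this is the asymptotic bound, and on the compact rest `[ε, b]` the continuous function
`‖F x‖ * x ^ (-e)` is bounded. -/
theorem exists_bound_of_isBigO_rpow {F : ℝ → ℂ} {b e : ℝ} (hF : ContinuousOn F (Ioc 0 b))
    (hO : F =O[𝓝[>] 0] fun x : ℝ => x ^ e) :
    ∃ K : ℝ, 0 ≤ K ∧ ∀ x ∈ Ioc 0 b, ‖F x‖ ≤ K * x ^ e := by
  obtain ⟨c, hc0, hc⟩ := hO.exists_nonneg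
  obtain ⟨ε, hε0, hε⟩ := mem_nhdsGT_iff_exists_Ioo_subset.1 hc.bound
  have hε0 : 0 < ε := hε0
  have hsub : Icc ε b ⊆ Ioc 0 b := fun x hx => ⟨hε0.trans_le hx.1, hx.2⟩
  have hcont : ContinuousOn (fun x => ‖F x‖ * x ^ (-e)) (Icc ε b) :=
    (hF.mono hsub).norm.mul (ContinuousOn.rpow_const continuousOn_id
      fun x hx => Or.inl (hε0.trans_le hx.1).ne')
  obtain ⟨C, hC⟩ := isCompact_Icc.exists_bound_of_continuousOn hcont
  refine ⟨max c C, hc0.trans (le_max_left _ _), fun x hx => ?_⟩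
  have hxe : 0 < x ^ e := Real.rpow_pos_of_pos hx.1 e
  rcases lt_or_ge x ε with h | h
  · have h1 : ‖F x‖ ≤ c * ‖x ^ e‖ := hε ⟨hx.1, h⟩
    rw [Real.norm_of_nonneg hxe.le] at h1
    exact h1.trans (mul_le_mul_of_nonneg_right (le_max_left _ _) hxe.le)
  · have h1 := (le_abs_self _).trans (hC x ⟨h, hx.2⟩)
    rw [Real.rpow_neg hx.1.le, ← div_eq_mul_inv, div_le_iff₀ hxe] at h1
    exact h1.trans (mul_le_mul_of_nonneg_right (le_max_right _ _) hxe.le)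

section

variable {L : ℝ} {q : ℕ} (a s : Fin (q + 1) → ℂ)

theorem hasDerivAt_sum_powDeriv (i : ℕ) {x : ℝ} (hx : 0 < x) :
    HasDerivAt (fun y => ∑ n, a n * powDeriv (s n) i y) (∑ n, a n * powDeriv (s n) (i + 1) x) x :=
  HasDerivAt.fun_sum fun n _ => (hasDerivAt_powDeriv (s n) i hx).const_mul (a n)

theorem iteratedDerivWithin_powerSum (i : ℕ) {x : ℝ} (hx : x ∈ Ioc 0 (L / 2)) :
    iteratedDerivWithin i (powerSum a s) (Ioc 0 (L / 2)) x = ∑ n, a n * powDeriv (s n) i x := by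
  induction i generalizing x with
  | zero => simp [powerSum, powDeriv_zero]
  | succ i ih =>
    rw [iteratedDerivWithin_succ, derivWithin_congr (fun y hy => ih hy) (ih hx)]
    exact (hasDerivAt_sum_powDeriv a s i hx.1).hasDerivWithinAt.derivWithin
      (uniqueDiffOn_Ioc _ _ x hx)

theorem contDiffOn_powerSum (m : ℕ) : ContDiffOn ℝ m (powerSum a s) (Ioc 0 (L / 2)) := by
  refine contDiffOn_of_differentiableOn_deriv (n := (m : ℕ∞)) fun i _ x hx => ?_
  refine DifferentiableWithinAt.congr
    (hasDerivAt_sum_powDeriv a s i hx.1).differentiableAt.differentiableWithinAt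
    (fun y hy => iteratedDerivWithin_powerSum a s i hy) (iteratedDerivWithin_powerSum a s i hx)

end

namespace IsAdmissible

variable {L : ℝ} {f : ℝ → WithTop ℂ} {p q : ℕ} {a s : Fin (q + 1) → ℂ} {δ : ℝ}

theorem contDiffOn_sub (hf : IsAdmissible L f p q a s δ) :
    ContDiffOn ℝ (2 * p + 1 : ℕ) (fun y => kernelValue f y - powerSum a s y) (Ioc 0 (L / 2)) :=
  hf.smooth.sub (contDiffOn_powerSum a s _)

theorem continuousOn_iteratedDerivWithin (hf : IsAdmissible L f p q a s δ) {i : ℕ}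
    (hi : i ≤ 2 * p + 1) : ContinuousOn
      (iteratedDerivWithin i (fun y => kernelValue f y - powerSum a s y) (Ioc 0 (L / 2)))
      (Ioc 0 (L / 2)) :=
  hf.contDiffOn_sub.continuousOn_iteratedDerivWithin (by exact_mod_cast hi) (uniqueDiffOn_Ioc _ _)

theorem hasDerivAt_iteratedDerivWithin (hf : IsAdmissible L f p q a s δ) {i : ℕ}
    (hi : i < 2 * p + 1) {x : ℝ} (hx : x ∈ Ioo 0 (L / 2)) : HasDerivAt
      (iteratedDerivWithin i (fun y => kernelValue f y - powerSum a s y) (Ioc 0 (L / 2)))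
      (iteratedDerivWithin (i + 1) (fun y => kernelValue f y - powerSum a s y) (Ioc 0 (L / 2)) x)
      x := by
  rw [iteratedDerivWithin_succ]
  exact (hf.contDiffOn_sub.differentiableOn_iteratedDerivWithin (by exact_mod_cast hi)
    (uniqueDiffOn_Ioc _ _) x ⟨hx.1, hx.2.le⟩).hasDerivWithinAt.hasDerivAt (Ioc_mem_nhds hx.1 hx.2)

theorem iteratedDerivWithin_sub_eq (hf : IsAdmissible L f p q a s δ) {i : ℕ}
    (hi : i ≤ 2 * p + 1) {x : ℝ} (hx : x ∈ Ioc 0 (L / 2)) :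
    iteratedDerivWithin i (fun y => kernelValue f y - powerSum a s y) (Ioc 0 (L / 2)) x =
      iteratedDerivWithin i (kernelValue f) (Ioc 0 (L / 2)) x -
        ∑ n, a n * powDeriv (s n) i x := by
  rw [← iteratedDerivWithin_powerSum a s i hx]
  exact iteratedDerivWithin_sub hx (uniqueDiffOn_Ioc _ _)
    ((hf.smooth x hx).of_le (by exact_mod_cast hi)) (contDiffOn_powerSum a s i x hx)

theorem exists_bound (hf : IsAdmissible L f p q a s δ) :
    ∃ K : ℝ, 0 ≤ K ∧ ∀ i ≤ 2 * p + 1, ∀ x ∈ Ioc 0 (L / 2),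
      ‖iteratedDerivWithin i (fun y => kernelValue f y - powerSum a s y) (Ioc 0 (L / 2)) x‖ ≤
        K * x ^ (δ - (s (Fin.last q)).re - i) := by
  have h : ∀ i, ∃ K : ℝ, 0 ≤ K ∧ (i ≤ 2 * p + 1 → ∀ x ∈ Ioc 0 (L / 2),
      ‖iteratedDerivWithin i (fun y => kernelValue f y - powerSum a s y) (Ioc 0 (L / 2)) x‖ ≤
        K * x ^ (δ - (s (Fin.last q)).re - i)) := by
    intro i
    by_cases hi : i ≤ 2 * p + 1
    · obtain ⟨K, hK, h⟩ := exists_bound_of_isBigO_rpow (hf.continuousOn_iteratedDerivWithin hi)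
        (hf.deriv_isBigO i hi)
      exact ⟨K, hK, fun _ => h⟩
    · exact ⟨0, le_rfl, fun h => absurd h hi⟩
  choose K hK0 hK using h
  refine ⟨∑ i ∈ Finset.range (2 * p + 2), K i, Finset.sum_nonneg fun i _ => hK0 i,
    fun i hi x hx => (hK i hi x hx).trans (mul_le_mul_of_nonneg_right ?_
      (Real.rpow_nonneg hx.1.le _))⟩
  exact Finset.single_le_sum (f := K) (fun i _ => hK0 i) (Finset.mem_range.2 (by lia))

/-- The bound of order `0` dominates the function by a power whose exponent exceeds `-1`, by
`delta_large`. -/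
theorem intervalIntegrable_sub (hf : IsAdmissible L f p q a s δ) (hL : 0 < L) :
    IntervalIntegrable (fun x => kernelValue f x - powerSum a s x) volume 0 (L / 2) := by
  obtain ⟨K, hK, hb⟩ := hf.exists_bound
  have hL2 : 0 ≤ L / 2 := by positivity
  have hβ : -1 < δ - (s (Fin.last q)).re := by linarith [hf.delta_large]
  have h1 := (intervalIntegral.intervalIntegrable_rpow' (a := 0) (b := L / 2) hβ).const_mul K
  rw [intervalIntegrable_iff_integrableOn_Ioc_of_le hL2] at h1 ⊢
  refine Integrable.mono' h1
    (hf.contDiffOn_sub.continuousOn.aestronglyMeasurable measurableSet_Ioc) ?_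
  filter_upwards [ae_restrict_mem measurableSet_Ioc] with x hx
  simpa using hb 0 (by lia) x hx

/-- Real parts strictly decrease, so every earlier exponent satisfies the strict inequality. -/
theorem last_exponent_or (hf : IsAdmissible L f p q a s δ) (n : Fin (q + 1)) :
    0 < (s n).re + 2 * p ∨ s n = -(2 * p : ℂ) := by
  rcases (Fin.le_last n).eq_or_lt with rfl | h
  · exact hf.last_exponent
  · left
    have h1 : (s (Fin.last q)).re < (s n).re := hf.re_strictAnti h
    rcases hf.last_exponent with h2 | h2
    · linarith
    · have : (s (Fin.last q)).re = -(2 * p) := by simp [h2]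
      linarith

theorem cyclicHalfSum_kernelValue (f : ℝ → WithTop ℂ) (a s : Fin (q + 1) → ℂ) (hL : 0 < L)
    (N : ℕ) :
    cyclicHalfSum N (fun k => kernelValue f (L / N * k)) =
      cyclicHalfSum N (fun k => iteratedDerivWithin 0
          (fun y => kernelValue f y - powerSum a s y) (Ioc 0 (L / 2)) (L / N * k)) +
        ∑ n, a n * ((L / N : ℝ) : ℂ) ^ (-s n) * cyclicHalfSum N (fun k => powDeriv (s n) 0 k) := by
  have h : ∀ m ∈ Finset.Ico 1 N, kernelValue f (L / N * (min m (N - m) : ℕ)) =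
      iteratedDerivWithin 0 (fun y => kernelValue f y - powerSum a s y) (Ioc 0 (L / 2))
        (L / N * (min m (N - m) : ℕ)) +
      ∑ n, a n * ((L / N : ℝ) : ℂ) ^ (-s n) * powDeriv (s n) 0 (min m (N - m) : ℕ) := by
    intro m hm
    rw [Finset.mem_Ico] at hm
    have hN : (0 : ℝ) < N := by exact_mod_cast (by lia : 0 < N)
    have hk : (0 : ℝ) < (min m (N - m) : ℕ) := by exact_mod_cast (by lia : 0 < min m (N - m))
    have e : powerSum a s (L / N * (min m (N - m) : ℕ)) =
        ∑ n, a n * ((L / N : ℝ) : ℂ) ^ (-s n) * powDeriv (s n) 0 (min m (N - m) : ℕ) := by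
      rw [powerSum]
      refine Finset.sum_congr rfl fun n _ => ?_
      rw [← powDeriv_zero, mul_assoc, ← powDeriv_mul (s n) 0 (div_pos hL hN) hk, pow_zero, one_mul]
    rw [iteratedDerivWithin_zero, e]
    ring
  simp only [cyclicHalfSum]
  rw [Finset.sum_congr rfl h, Finset.sum_add_distrib, Finset.sum_comm, add_div,
    Finset.sum_div Finset.univ]
  congr 1
  refine Finset.sum_congr rfl fun n _ => ?_
  rw [← Finset.mul_sum]
  ring

/-- The derivatives of `f` at `L / 2` split into those of `f - S_q` and of the powers. Since `L / 2
= h * (N / 2)`, homogeneity turns the latter into the boundary terms at `N / 2` of the cyclic power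
sums. -/
theorem bernoulliSum_eq (hf : IsAdmissible L f p q a s δ) (hL : 0 < L) {N : ℕ} (hN : 2 ≤ N) :
    bernoulliSum L f p N =
      2 * N * (∑ n ∈ Finset.Icc 1 p, scaledBernoulli (2 * n) ((N % 2 : ℕ) / 2) *
          (((L / N : ℝ) : ℂ) ^ (2 * n - 1) * iteratedDerivWithin (2 * n - 1)
            (fun y => kernelValue f y - powerSum a s y) (Ioc 0 (L / 2)) (L / 2)) +
        ∑ m, a m * ((L / N : ℝ) : ℂ) ^ (-s m) * ∑ n ∈ Finset.Icc 1 p,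
          scaledBernoulli (2 * n) ((N % 2 : ℕ) / 2) * powDeriv (s m) (2 * n - 1) (N / 2)) := by
  have hN0 : (0 : ℝ) < N := by exact_mod_cast (by lia : 0 < N)
  have hNc : (N : ℂ) ≠ 0 := by exact_mod_cast hN0.ne'
  have hLc : (L : ℂ) ≠ 0 := by exact_mod_cast hL.ne'
  set h : ℝ := L / N with hh
  have hh0 : 0 < h := div_pos hL hN0
  have hhN : h * (N / 2) = L / 2 := by rw [hh]; field_simp
  simp only [Finset.mul_sum]
  rw [Finset.sum_comm, ← Finset.sum_add_distrib, bernoulliSum, Finset.mul_sum, Finset.mul_sum]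
  refine Finset.sum_congr rfl fun n hn => ?_
  rw [Finset.mem_Icc] at hn
  rw [hf.iteratedDerivWithin_sub_eq (by lia) ⟨by positivity, le_rfl⟩]
  have h1 : ∑ m, a m * (h : ℂ) ^ (-s m) * (scaledBernoulli (2 * n) ((N % 2 : ℕ) / 2) *
      powDeriv (s m) (2 * n - 1) (N / 2)) = scaledBernoulli (2 * n) ((N % 2 : ℕ) / 2) *
      ((h : ℂ) ^ (2 * n - 1) * ∑ m, a m * powDeriv (s m) (2 * n - 1) (L / 2)) := by
    rw [Finset.mul_sum, Finset.mul_sum]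
    refine Finset.sum_congr rfl fun m _ => ?_
    have := powDeriv_mul (s m) (2 * n - 1) hh0 (x := N / 2) (by positivity)
    rw [hhN] at this
    linear_combination (-a m * scaledBernoulli (2 * n) ((N % 2 : ℕ) / 2)) * this
  have h2 : (scaledBernoulli (2 * n) ((N % 2 : ℕ) / 2) : ℂ) =
      (((Polynomial.bernoulli (2 * n)).eval (((N % 2 : ℕ) : ℚ) / 2) : ℚ) : ℂ) /
        ((2 * n).factorial : ℂ) := by
    have : bernoulliFun (2 * n) ((N % 2 : ℕ) / 2) =
        (((Polynomial.bernoulli (2 * n)).eval (((N % 2 : ℕ) : ℚ) / 2) : ℚ) : ℝ) := by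
      rw [bernoulliFun, show ((N % 2 : ℕ) / 2 : ℝ) = algebraMap ℚ ℝ (((N % 2 : ℕ) : ℚ) / 2) by simp,
        Polynomial.eval_map_apply]
      rfl
    rw [scaledBernoulli, this]
    push_cast
    rfl
  have h3 : ((L : ℂ) / N) ^ (2 * n) = (h : ℂ) ^ (2 * n - 1) * (L / N) := by
    rw [hh, Complex.ofReal_div, Complex.ofReal_natCast, ← pow_succ, Nat.sub_add_cancel (by lia)]
  rw [h1, h2, h3]
  field_simp
  ring

/-- From `L / 2 = h * (N / 2)` one gets `(L/2)^{1-s} = h * h^{-s} * (N/2)^{1-s}`, so the `N²` term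
collects the main integrals of both parts. -/
theorem leadingCoeff_mul_sq (hL : 0 < L) {N : ℕ} (hN : 2 ≤ N) :
    leadingCoeff L f a s * (N : ℂ) ^ 2 =
      2 * N * (((L / N : ℝ) : ℂ)⁻¹ * (∫ x in (0 : ℝ)..(L / 2), (kernelValue f x - powerSum a s x)) +
        ∑ n, a n * ((L / N : ℝ) : ℂ) ^ (-s n) * (((N / 2 : ℝ) : ℂ) ^ (1 - s n) / (1 - s n))) := by
  have hN0 : (0 : ℝ) < N := by exact_mod_cast (by lia : 0 < N)
  have hNc : (N : ℂ) ≠ 0 := by exact_mod_cast hN0.ne'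
  have hLc : (L : ℂ) ≠ 0 := by exact_mod_cast hL.ne'
  have h : ∀ n, a n * (((L : ℂ) / 2) ^ (1 - s n) / (1 - s n)) = (L / N) *
      (a n * ((L / N : ℝ) : ℂ) ^ (-s n) * (((N / 2 : ℝ) : ℂ) ^ (1 - s n) / (1 - s n))) := by
    intro n
    have h0 : ((L / N : ℝ) : ℂ) ≠ 0 := by exact_mod_cast (div_pos hL hN0).ne'
    have e : (L : ℂ) / 2 = ((L / N : ℝ) : ℂ) * ((N / 2 : ℝ) : ℂ) := by
      push_cast
      field_simp
    rw [e, Complex.mul_cpow_ofReal_nonneg (by positivity) (by positivity),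
      sub_eq_add_neg 1 (s n), Complex.cpow_add _ _ h0, Complex.cpow_one]
    push_cast
    ring
  rw [leadingCoeff, Finset.sum_congr rfl fun n _ => h n, ← Finset.mul_sum]
  push_cast
  field_simp
  ring

theorem zeta_term_eq (hL : 0 < L) {N : ℕ} (hN : 2 ≤ N) (w z : ℂ) :
    2 * z / (L : ℂ) ^ w * (N : ℂ) ^ (1 + w) = 2 * N * (((L / N : ℝ) : ℂ) ^ (-w) * z) := by
  have hN0 : (0 : ℝ) < N := by exact_mod_cast (by lia : 0 < N)
  have hNc : (N : ℂ) ≠ 0 := by exact_mod_cast hN0.ne'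
  have h0 : ((L / N : ℝ) : ℂ) ≠ 0 := by exact_mod_cast (div_pos hL hN0).ne'
  have e : (L : ℂ) = ((L / N : ℝ) : ℂ) * ((N : ℝ) : ℂ) := by
    push_cast
    field_simp
  have h1 : ((L / N : ℝ) : ℂ) ^ w ≠ 0 := fun h => h0 ((Complex.cpow_eq_zero_iff _ _).1 h).1
  have h2 : (N : ℂ) ^ w ≠ 0 := fun h => hNc ((Complex.cpow_eq_zero_iff _ _).1 h).1
  rw [e, Complex.mul_cpow_ofReal_nonneg (by positivity) (by positivity), Complex.cpow_add _ _ hNc,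
    Complex.cpow_one, Complex.cpow_neg, Complex.ofReal_natCast]
  field_simp

/-- The discretization error of the kernel, up to a factor `2 N`. -/
theorem remainder_eq (hf : IsAdmissible L f p q a s δ) (hL : 0 < L) (hs : ∀ n, s n ≠ 1) {N : ℕ}
    (hN : 2 ≤ N) :
    2 * N * cyclicHalfSum N (fun k => kernelValue f (L / N * k)) -
      (leadingCoeff L f a s * (N : ℂ) ^ 2 +
        ∑ n, a n * (2 * riemannZeta (s n) / (L : ℂ) ^ s n) * (N : ℂ) ^ (1 + s n) +
        bernoulliSum L f p N) =
    2 * N * (cyclicHalfSum N (fun k => iteratedDerivWithin 0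
          (fun y => kernelValue f y - powerSum a s y) (Ioc 0 (L / 2)) (L / N * k)) -
        (((L / N : ℝ) : ℂ)⁻¹ * ∫ x in (0 : ℝ)..(L / 2), iteratedDerivWithin 0
          (fun y => kernelValue f y - powerSum a s y) (Ioc 0 (L / 2)) x) -
        ∑ n ∈ Finset.Icc 1 p, scaledBernoulli (2 * n) ((N % 2 : ℕ) / 2) *
          (((L / N : ℝ) : ℂ) ^ (2 * n - 1) * iteratedDerivWithin (2 * n - 1)
            (fun y => kernelValue f y - powerSum a s y) (Ioc 0 (L / 2)) (L / 2))) -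
      2 * N * ∑ n, a n * ((L / N : ℝ) : ℂ) ^ (-s n) *
        ∫ x in Ioi (N / 2 : ℝ), periodicBernoulli (2 * p + 1) x *
          powDeriv (s n) (2 * p + 1) x := by
  have h1 := cyclicHalfSum_kernelValue f a s hL N
  simp only [fun n => cyclicHalfSum_powDeriv_eq p (hf.last_exponent_or n) (hs n) hN,
    mul_sub, mul_add, Finset.sum_add_distrib, Finset.sum_sub_distrib] at h1
  have h2 := leadingCoeff_mul_sq (f := f) (a := a) (s := s) hL hN
  have h3 := hf.bernoulliSum_eq hL hN
  have h4 : ∑ n, a n * (2 * riemannZeta (s n) / (L : ℂ) ^ s n) * (N : ℂ) ^ (1 + s n) =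
      2 * N * ∑ n, a n * ((L / N : ℝ) : ℂ) ^ (-s n) * riemannZeta (s n) := by
    rw [Finset.mul_sum]
    refine Finset.sum_congr rfl fun n _ => ?_
    rw [mul_assoc, zeta_term_eq hL hN]
    ring
  rw [h1, h2, h3, h4]
  simp only [iteratedDerivWithin_zero]
  ring

/-- The remainder of the asymptotic expansion of the discrete energy. -/
theorem exists_bound_remainder (hf : IsAdmissible L f p q a s δ) (hL : 0 < L) (hs : ∀ n, s n ≠ 1) :
    ∃ K₁ K₂ : ℝ, 0 ≤ K₁ ∧ 0 ≤ K₂ ∧ ∀ N : ℕ, 2 ≤ N →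
      ‖2 * N * cyclicHalfSum N (fun k => kernelValue f (L / N * k)) -
        (leadingCoeff L f a s * (N : ℂ) ^ 2 +
          ∑ n, a n * (2 * riemannZeta (s n) / (L : ℂ) ^ s n) * (N : ℂ) ^ (1 + s n) +
          bernoulliSum L f p N)‖ ≤
      N * (K₁ * ((N : ℝ) ^ (-(δ - (s (Fin.last q)).re)) * (1 + ∫ x in (1 : ℝ)..(N / 2),
        x ^ (δ - (s (Fin.last q)).re - (2 * p + 1 : ℕ)))) + K₂ * (N : ℝ) ^ (-(2 * p) : ℝ)) := by
  obtain ⟨K, hK, hb⟩ := hf.exists_bound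
  have hi := hf.intervalIntegrable_sub hL
  obtain ⟨K₁, hK₁, h₁⟩ := exists_bound_cyclicHalfSum_sub p
    (fun i => iteratedDerivWithin i (fun y => kernelValue f y - powerSum a s y) (Ioc 0 (L / 2)))
    hL (by linarith [hf.delta_large]) hK (fun i => hf.continuousOn_iteratedDerivWithin)
    (fun i hi x => hf.hasDerivAt_iteratedDerivWithin hi) hb
    (by simpa only [iteratedDerivWithin_zero] using hi)
  choose K' hK' h' using fun n =>
    exists_bound_integral_Ioi_periodicBernoulli p (hf.last_exponent_or n)
  refine ⟨2 * K₁, 2 * ∑ n, ‖a n‖ * L ^ (-(s n).re) * K' n, by positivity,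
    mul_nonneg two_pos.le (Finset.sum_nonneg fun n _ => mul_nonneg (by positivity) (hK' n)),
    fun N hN => ?_⟩
  have hN0 : (0 : ℝ) < N := by exact_mod_cast (by lia : 0 < N)
  rw [hf.remainder_eq hL hs hN]
  -- The factor `(L / N) ^ (-s n)` has modulus proportional to `N ^ (Re s_n)`, which cancels the
  -- dependence of the tail bound on `n` and leaves `N ^ (-2p)`.
  have h2 : ‖∑ n, a n * ((L / N : ℝ) : ℂ) ^ (-s n) * ∫ x in Ioi (N / 2 : ℝ),
      periodicBernoulli (2 * p + 1) x * powDeriv (s n) (2 * p + 1) x‖ ≤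
      (∑ n, ‖a n‖ * L ^ (-(s n).re) * K' n) * (N : ℝ) ^ (-(2 * p) : ℝ) := by
    rw [Finset.sum_mul]
    refine norm_sum_le_of_le _ fun n _ => ?_
    rw [norm_mul, norm_mul, Complex.norm_cpow_eq_rpow_re_of_pos (div_pos hL hN0), Complex.neg_re]
    refine (mul_le_mul_of_nonneg_left (h' n N hN) (by positivity)).trans (le_of_eq ?_)
    rw [Real.div_rpow hL.le hN0.le, Real.rpow_sub hN0, Real.rpow_neg hN0.le (2 * p)]
    have := (Real.rpow_pos_of_pos hN0 (-(s n).re)).ne'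
    field_simp
  refine (norm_sub_le _ _).trans ?_
  rw [norm_mul, norm_mul (2 * N : ℂ), norm_mul, Complex.norm_ofNat, Complex.norm_natCast]
  calc _ ≤ 2 * N * (K₁ * ((N : ℝ) ^ (-(δ - (s (Fin.last q)).re)) * (1 + ∫ x in (1 : ℝ)..(N / 2),
        x ^ (δ - (s (Fin.last q)).re - (2 * p + 1 : ℕ))))) +
        2 * N * ((∑ n, ‖a n‖ * L ^ (-(s n).re) * K' n) * (N : ℝ) ^ (-(2 * p) : ℝ)) :=
        add_le_add (mul_le_mul_of_nonneg_left (h₁ N hN) (by positivity))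
          (mul_le_mul_of_nonneg_left h2 (by positivity))
    _ = _ := by ring

end IsAdmissible

end

/-! ### The asymptotic expansion -/

theorem mainTheorem1 (d : ℕ) (hd : 2 ≤ d) (Γ : RectifiableSimpleClosedCurve d)
    (f : ℝ → WithTop ℂ) (p q : ℕ) (hp : 1 ≤ p) (a s : Fin (q + 1) → ℂ) (δ : ℝ)
    (hf : IsAdmissible Γ.length f p q a s δ) (hs : ∀ n, s n ≠ 1) :
    IntervalIntegrable (fun x => kernelValue f x - powerSum a s x) volume 0 (Γ.length / 2) ∧
    ∃ R : ℕ → ℂ,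
      (∀ N : ℕ, 2 ≤ N → ∀ z : Fin N → EuclideanSpace ℝ (Fin d), Γ.IsEquallySpaced z →
        Γ.energy f z =
          ((leadingCoeff Γ.length f a s * (N : ℂ) ^ 2 +
            ∑ n, a n * (2 * riemannZeta (s n) / (Γ.length : ℂ) ^ s n) * (N : ℂ) ^ (1 + s n) +
            bernoulliSum Γ.length f p N + R N : ℂ) : WithTop ℂ)) ∧
      ((2 * p : ℝ) ≠ δ - (s (Fin.last q)).re →
        R =O[atTop] fun N : ℕ =>
          (N : ℝ) ^ (1 - 2 * p : ℝ) + (N : ℝ) ^ (1 - δ + (s (Fin.last q)).re)) ∧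
      ((2 * p : ℝ) = δ - (s (Fin.last q)).re →
        R =O[atTop] fun N : ℕ => (N : ℝ) ^ (1 - 2 * p : ℝ) * Real.log N) := by
  have hL := Γ.length_pos
  -- The remainder is defined through kernel values at the multiples of `|Γ| / N`, without reference
  -- to the points, so it is independent of their choice.
  refine ⟨hf.intervalIntegrable_sub hL, fun N =>
    2 * N * cyclicHalfSum N (fun k => kernelValue f (Γ.length / N * k)) -
      (leadingCoeff Γ.length f a s * (N : ℂ) ^ 2 +
        ∑ n, a n * (2 * riemannZeta (s n) / (Γ.length : ℂ) ^ s n) * (N : ℂ) ^ (1 + s n) +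
        bernoulliSum Γ.length f p N), fun N _ z hz => ?_, fun hne => ?_, fun heq => ?_⟩
  · rw [hz.energy_eq f hf.finite]
    congr 1
    ring
  · obtain ⟨K₁, K₂, hK₁, hK₂, h⟩ := hf.exists_bound_remainder hL hs
    obtain ⟨K, hK, hb⟩ := exists_bound_rpow_mul_one_add_integral hne
    refine IsBigO.of_bound (K₁ * K + K₂) ?_
    filter_upwards [eventually_ge_atTop 2] with N hN
    have hN0 : (0 : ℝ) < N := by exact_mod_cast (by lia : 0 < N)
    refine (h N hN).trans ?_
    rw [Real.norm_of_nonneg (by positivity),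
      show (1 - 2 * p : ℝ) = -(2 * p) + 1 by ring, Real.rpow_add_one hN0.ne',
      show 1 - δ + (s (Fin.last q)).re = -(δ - (s (Fin.last q)).re) + 1 by ring,
      Real.rpow_add_one hN0.ne']
    set P := (N : ℝ) ^ (-(2 * p) : ℝ)
    set Q := (N : ℝ) ^ (-(δ - (s (Fin.last q)).re)) with hQ
    have hQ0 : 0 ≤ Q := by positivity
    calc _ ≤ N * (K₁ * (K * (P + Q)) + K₂ * (P + Q)) := by
          refine mul_le_mul_of_nonneg_left (add_le_add
            (mul_le_mul_of_nonneg_left (hb N hN) hK₁) ?_) hN0.le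
          exact mul_le_mul_of_nonneg_left (by linarith) hK₂
      _ = _ := by ring
  · obtain ⟨K₁, K₂, hK₁, hK₂, h⟩ := hf.exists_bound_remainder hL hs
    obtain ⟨K, hK, hb⟩ := exists_bound_rpow_mul_one_add_integral_of_eq heq
    have hl2 : 0 < Real.log 2 := Real.log_pos (by norm_num)
    refine IsBigO.of_bound (K₁ * K + K₂ / Real.log 2) ?_
    filter_upwards [eventually_ge_atTop 2] with N hN
    have hN2 : (2 : ℝ) ≤ N := by exact_mod_cast hN
    have hN0 : (0 : ℝ) < N := by linarith
    have hlog : Real.log 2 ≤ Real.log N := Real.log_le_log (by norm_num) hN2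
    have hlog0 : 0 ≤ Real.log N := hl2.le.trans hlog
    refine (h N hN).trans ?_
    rw [Real.norm_of_nonneg (by positivity),
      show (1 - 2 * p : ℝ) = -(2 * p) + 1 by ring, Real.rpow_add_one hN0.ne']
    set P := (N : ℝ) ^ (-(2 * p) : ℝ)
    have hP0 : 0 ≤ P := by positivity
    calc _ ≤ N * (K₁ * (K * (P * Real.log N)) + K₂ / Real.log 2 * (P * Real.log N)) := by
          refine mul_le_mul_of_nonneg_left (add_le_add
            (mul_le_mul_of_nonneg_left (hb N hN) hK₁) ?_) hN0.le
          -- The tail term `N ^ (-2p)` carries no logarithm and is absorbed through `log 2 ≤ log N`.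
          rw [div_mul_eq_mul_div, le_div_iff₀ hl2, mul_assoc]
          exact mul_le_mul_of_nonneg_left (mul_le_mul_of_nonneg_left hlog hP0) hK₂
      _ = _ := by ring
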